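/- All Hilbert spaces are finite-dimensional and $\log$ is the base-two logarithm, with $\log 0=-\infty$ and $\log\infty=\infty$. For positive semidefinite $P,Q$ let $F(P,Q)=\|\sqrt P\sqrt Q\|_1^2$ be the fidelity. For subnormalized states $\rho,\sigma$ (positive semidefinite operators of trace at most $1$) let $$P(\rho,\sigma)=\sqrt{1-F\bigl(\rho\oplus[1-\operatorname{Tr}\rho],\ \sigma\oplus[1-\operatorname{Tr}\sigma]\bigr)}$$ be the purified distance. For a state $\rho_{AB}$ on $\mathcal H_A\otimes\mathcal H_B$, the smooth conditional max-entropy is $$H_{\max}^{\xi}(A|B)_\rho=\inf_{\tilde\rho_{AB}}\ \sup_{\sigma_B}\ \log F(\tilde\rho_{AB},I_A\otimes\sigma_B),$$ where the infimum is over subnormalized states $\tilde\rho_{AB}$ with $P(\rho_{AB},\tilde\rho_{AB})\le\xi$ and the supremum is over states $\sigma_B$. A one-way LOCC channel from Alice to Bob is a map $\Lambda_{AB\to A'B'}=\sum_x\mathcal E^x_{A\to A'}\otimes\mathcal F^x_{B\to B'}$ (finite sum) with every $\mathcal E^x$ completely positive, $\sum_x\mathcal E^x$ a quantum channel, and every $\mathcal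 F^x$ a quantum channel. **Proposition.** Let $\rho_{AB}$ be a state, $\varepsilon\in[0,1]$ and $\eta\in[0,\sqrt\varepsilon)$. For every integer $d\ge 1$ with $$\log d\ \le\ -H_{\max}^{\sqrt\varepsilon-\eta}(A|B)_\rho-4\log\frac1\eta$$ there is a one-way LOCC channel $\Lambda_{AB\to A'B'}$ with classical communication from Alice to Bob, where $\dim\mathcal H_{A'}=\dim\mathcal H_{B'}=d$, such that $$F\bigl(\Phi_{A'B'},\Lambda_{AB\to A'B'}(\rho_{AB})\bigr)\ \ge\ 1-\varepsilon,$$ where $\Phi_{A'B'}=|\Phi\rangle\langle\Phi|$ with $|\Phi\rangle=\frac1{\sqrt d}\sum_{i=0}^{d-1}|i\rangle\otimes|i\rangle$ is the maximally entangled state of Schmidt rank $d$. (For $\eta=0$ the right-hand side of the condition on $d$ is $-\infty$, and nothing is claimed.) -/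

import Mathlib

open scoped Matrix Kronecker ComplexOrder MatrixOrder ENNReal

noncomputable section

namespace QInfo

/-- Operators on the finite-dimensional Hilbert space with standard basis indexed by `n`. -/
abbrev Op (n : Type*) := Matrix n n ℂ

section States

variable {n : Type*} [Fintype n]

/-- Density operators. -/
def IsState (ρ : Op n) : Prop := ρ.PosSemidef ∧ ρ.trace = 1

/-- Subnormalized density operators. -/
def IsSubState (ρ : Op n) : Prop := ρ.PosSemidef ∧ ρ.trace.re ≤ 1

variable [DecidableEq n]

/-- The trace norm `‖C‖₁ = Tr √(C† C)`. -/
def traceNorm (C : Op n) : ℝ := (CFC.sqrt (Cᴴ * C)).trace.re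

/-- The (squared) fidelity `F(P, Q) = ‖√P √Q‖₁²` of positive semidefinite operators. -/
def fidelity (P Q : Op n) : ℝ := traceNorm (CFC.sqrt P * CFC.sqrt Q) ^ 2

/-- The sine distance `C(ρ, σ) = √(1 - F(ρ, σ))`. -/
def sineDist (ρ σ : Op n) : ℝ := √(1 - fidelity ρ σ)

/-- The normalized extension `ρ ⊕ [1 - Tr ρ]`, an operator on the space with one more dimension. -/
def extend (ρ : Op n) : Op (n ⊕ Unit) :=
  Matrix.fromBlocks ρ 0 0 (fun _ _ => 1 - ρ.trace)

/-- The purified distance of subnormalized states. -/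
def purifiedDist (ρ σ : Op n) : ℝ := sineDist (extend ρ) (extend σ)

/-- The ball of subnormalized states of radius `ξ` around `ρ` in purified distance. -/
def purifiedBall (ξ : ℝ) (ρ : Op n) : Set (Op n) :=
  {ρ' | IsSubState ρ' ∧ purifiedDist ρ ρ' ≤ ξ}

end States

/-- The base-two logarithm on `[0, ∞]`, with `log 0 = -∞` and `log ∞ = ∞`. -/
def log2 (x : ℝ≥0∞) : EReal := ENNReal.log x / ((Real.log 2 : ℝ) : EReal)

/-- The smooth conditional max-entropy
`H_max^ξ(A|B)_ρ = inf_{ρ' ∈ B^ξ(ρ)} sup_{σ_B} log F(ρ', I_A ⊗ σ_B)`. -/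
def smoothMaxEntropy {A B : Type*} [Fintype A] [DecidableEq A] [Fintype B] [DecidableEq B]
    (ξ : ℝ) (ρ : Op (A × B)) : EReal :=
  ⨅ ρ' ∈ purifiedBall ξ ρ, ⨆ σ ∈ {σ : Op B | IsState σ},
    log2 (ENNReal.ofReal (fidelity ρ' ((1 : Op A) ⊗ₖ σ)))

section Maps

variable {A B A' B' : Type*} [Fintype A] [DecidableEq A] [Fintype B] [DecidableEq B]

/-- The tensor product `E ⊗ F` of two linear maps on operators, given on matrix units by
`|a⟩⟨a'| ⊗ |b⟩⟨b'| ↦ E(|a⟩⟨a'|) ⊗ F(|b⟩⟨b'|)`. -/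
def tensorMap (E : Op A →ₗ[ℂ] Op A') (F : Op B →ₗ[ℂ] Op B') :
    Op (A × B) →ₗ[ℂ] Op (A' × B') where
  toFun X := ∑ a, ∑ a', ∑ b, ∑ b',
    X (a, b) (a', b') • (E (Matrix.single a a' 1) ⊗ₖ F (Matrix.single b b' 1))
  map_add' X Y := by
    simp only [Matrix.add_apply, add_smul, Finset.sum_add_distrib]
  map_smul' c X := by
    simp only [Matrix.smul_apply, smul_eq_mul, mul_smul, Finset.smul_sum, RingHom.id_apply]

theorem tensorMap_kronecker (E : Op A →ₗ[ℂ] Op A') (F : Op B →ₗ[ℂ] Op B')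
    (X : Op A) (Y : Op B) : tensorMap E F (X ⊗ₖ Y) = E X ⊗ₖ F Y := by
  have hX : E X = ∑ a, ∑ a', X a a' • E (Matrix.single a a' 1) := by
    conv_lhs => rw [Matrix.matrix_eq_sum_single X]
    simp [map_sum, ← LinearMap.map_smul]
  have hY : F Y = ∑ b, ∑ b', Y b b' • F (Matrix.single b b' 1) := by
    conv_lhs => rw [Matrix.matrix_eq_sum_single Y]
    simp [map_sum, ← LinearMap.map_smul]
  ext i j
  rw [hX, hY]
  simp only [tensorMap, LinearMap.coe_mk, AddHom.coe_mk, Matrix.kroneckerMap_apply,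
    Matrix.sum_apply, Matrix.smul_apply, smul_eq_mul]
  simp_rw [Finset.sum_mul, Finset.mul_sum]
  congr! 4
  ring

variable [Fintype A'] [Fintype B']

/-- Complete positivity: `id_R ⊗ N` is positive for reference systems `R` of every finite size. -/
def IsCP (N : Op A →ₗ[ℂ] Op A') : Prop :=
  ∀ (k : ℕ) (X : Op (Fin k × A)), X.PosSemidef →
    (tensorMap (LinearMap.id : Op (Fin k) →ₗ[ℂ] Op (Fin k)) N X).PosSemidef

/-- Quantum channels: completely positive trace-preserving linear maps. -/
def IsChannel (N : Op A →ₗ[ℂ] Op A') : Prop :=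
  IsCP N ∧ ∀ X, (N X).trace = X.trace

/-- One-way LOCC channels with communication from Alice to Bob: Alice applies a quantum instrument
`{E x}`, sends the classical outcome `x` to Bob, and Bob applies a channel `F x`; in total the
channel is `∑ x, E x ⊗ F x`. -/
def IsOneWayLOCC (L : Op (A × B) →ₗ[ℂ] Op (A' × B')) : Prop :=
  ∃ (m : ℕ) (E : Fin m → Op A →ₗ[ℂ] Op A') (F : Fin m → Op B →ₗ[ℂ] Op B'),
    (∀ x, IsCP (E x)) ∧ IsChannel (∑ x, E x) ∧ (∀ x, IsChannel (F x)) ∧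
      L = ∑ x, tensorMap (E x) (F x)

end Maps

/-- The maximally entangled state vector `|Φ⟩ = d^{-1/2} ∑ i, |i⟩ ⊗ |i⟩`. -/
def maxEntVec (d : ℕ) : Fin d × Fin d → ℂ :=
  fun p => if p.1 = p.2 then ((1 / √(d : ℝ) : ℝ) : ℂ) else 0

/-- The maximally entangled state `|Φ⟩⟨Φ|` of Schmidt rank `d`. -/
def maxEntState (d : ℕ) : Op (Fin d × Fin d) :=
  Matrix.vecMulVec (maxEntVec d) (star (maxEntVec d))

end QInfo

end

/-! Purify a nearby state ρ' by the matrix R = √ρ', whose column index is the purifying system E.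
Alice's Kraus operators are proportional to d × |A| matrices of independent third roots of unity,
one matrix for each outcome, and she announces the outcome. The proof is a decoupling argument: on
average the unnormalized state of A'E is close to 1 ⊗ ρ'_E, and Bob, who holds the rest of the
purification, can then produce a maximally entangled state with A' by Uhlmann's theorem.

Closeness is measured in a weighted Hilbert-Schmidt norm, where pairwise orthogonality of the phases
gives the variance (`sum_hsSq_phaseMatrix_sub_le`). The weight comes from an operator σ_E with ψ_AE
≤ 1 ⊗ σ_E and trace at most κ, where κ bounds F(ρ', 1 ⊗ σ_B) for all σ_B. That such a σ_E exists is
the duality between max-entropy given B and min-entropy given E: `re_trace_mul_reshape_le` bounds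
the dual problem by a fidelity, and `exists_one_kronecker_ge` turns that bound into σ_E.
Powers-Størmer converts trace distance into overlap (`exists_decoder`), and the average overlap is
at least Tr ρ' - √(dκ)/2 (`exists_decoders`).

The true input is ρ, not ρ'. The performance on ρ is bounded below by the squared norm of V√ρ for a
contraction V that collects amplitudes against Φ. Pulling the ideal output back through V gives a
vector whose angle to the purification of ρ' has sine at most η; the angle from ρ' to ρ has sine at
most √ε - η, and sines of angles obey a triangle inequality (`overlap_bound`). Since κ is about
η⁴/d, the overlap is about 1 - η²/2, whose square exceeds 1 - η² strictly. This slack pays for an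
infimum that need not be attained and for making σ_E invertible. -/

noncomputable section

namespace QInfo

/-! ### Hilbert-Schmidt norm, contractions and polar decomposition -/

section MatrixLemmas

set_option linter.unusedSectionVars false

variable {n m l : Type*} [Fintype n] [Fintype m] [Fintype l]

/-- The squared Hilbert-Schmidt norm. -/
def hsSq (X : Matrix m n ℂ) : ℝ := ∑ i, ∑ j, ‖X i j‖ ^ 2

theorem hsSq_nonneg (X : Matrix m n ℂ) : 0 ≤ hsSq X := by
  unfold hsSq; positivity

theorem trace_conjTranspose_mul (X Y : Matrix m n ℂ) :
    (Xᴴ * Y).trace = ∑ i, ∑ j, star (X i j) * Y i j := by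
  rw [Finset.sum_comm]
  simp [Matrix.trace, Matrix.mul_apply, Matrix.conjTranspose_apply]

theorem trace_conjTranspose_mul_self (X : Matrix m n ℂ) : (Xᴴ * X).trace = (hsSq X : ℂ) := by
  rw [trace_conjTranspose_mul]
  simp [hsSq, Complex.conj_mul']

theorem trace_mul_conjTranspose_self (X : Matrix m n ℂ) : (X * Xᴴ).trace = (hsSq X : ℂ) := by
  rw [Matrix.trace_mul_comm, trace_conjTranspose_mul_self]

theorem hsSq_conjTranspose (X : Matrix m n ℂ) : hsSq Xᴴ = hsSq X := by
  unfold hsSq; rw [Finset.sum_comm]; simp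

theorem norm_trace_conjTranspose_mul_sq_le (X Y : Matrix m n ℂ) :
    ‖(Xᴴ * Y).trace‖ ^ 2 ≤ hsSq X * hsSq Y := by
  have h1 : ‖(Xᴴ * Y).trace‖ ≤ ∑ p : m × n, ‖X p.1 p.2‖ * ‖Y p.1 p.2‖ := by
    rw [trace_conjTranspose_mul, ← Fintype.sum_prod_type']
    refine (norm_sum_le _ _).trans (le_of_eq ?_)
    simp
  calc _ ≤ (∑ p : m × n, ‖X p.1 p.2‖ * ‖Y p.1 p.2‖) ^ 2 := by gcongr
    _ ≤ _ := by
      simpa only [hsSq, Fintype.sum_prod_type] using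
        Finset.sum_mul_sq_le_sq_mul_sq Finset.univ (fun p : m × n => ‖X p.1 p.2‖)
          (fun p : m × n => ‖Y p.1 p.2‖)

theorem norm_trace_conjTranspose_mul_le (X Y : Matrix m n ℂ) :
    ‖(Xᴴ * Y).trace‖ ≤ √(hsSq X) * √(hsSq Y) := by
  rw [← Real.sqrt_mul (hsSq_nonneg X)]
  exact Real.le_sqrt_of_sq_le (norm_trace_conjTranspose_mul_sq_le X Y)

theorem re_trace_nonneg {X : Op n} (hX : X.PosSemidef) : 0 ≤ X.trace.re :=
  (Complex.le_def.1 hX.trace_nonneg).1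

theorem re_trace_le {X Y : Op n} (h : (Y - X).PosSemidef) : X.trace.re ≤ Y.trace.re := by
  have := re_trace_nonneg h
  simp only [Matrix.trace_sub, Complex.sub_re] at this
  linarith

theorem ofReal_re_trace {X : Op n} (hX : X.PosSemidef) : ((X.trace.re : ℝ) : ℂ) = X.trace := by
  have := (Complex.le_def.1 hX.trace_nonneg).2
  apply Complex.ext <;> simp [← this]

variable [DecidableEq n] [DecidableEq m] [DecidableEq l]

theorem posSemidef_sqrt (P : Op n) : (CFC.sqrt P).PosSemidef :=
  Matrix.nonneg_iff_posSemidef.1 (CFC.sqrt_nonneg P)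

theorem conjTranspose_sqrt (P : Op n) : (CFC.sqrt P)ᴴ = CFC.sqrt P :=
  (posSemidef_sqrt P).isHermitian

theorem sqrt_mul_sqrt {P : Op n} (hP : P.PosSemidef) : CFC.sqrt P * CFC.sqrt P = P :=
  CFC.sqrt_mul_sqrt_self P hP.nonneg

theorem re_trace_mul_nonneg {X Y : Op n} (hX : X.PosSemidef) (hY : Y.PosSemidef) :
    0 ≤ (X * Y).trace.re := by
  have h := re_trace_nonneg (hY.mul_mul_conjTranspose_same (CFC.sqrt X))
  rwa [conjTranspose_sqrt, Matrix.trace_mul_comm, ← mul_assoc, sqrt_mul_sqrt hX] at h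

/-- `T` is a contraction. -/
def IsContr (T : Matrix m n ℂ) : Prop := (1 - Tᴴ * T).PosSemidef

/-- Both conditions are Schur complements of the same block matrix, with identities on the diagonal
and T off it. -/
theorem IsContr.conjTranspose {T : Matrix m n ℂ} (hT : IsContr T) : IsContr Tᴴ := by
  have h1 : (1 - Tᴴ * (1 : Op m)⁻¹ * T).PosSemidef := by simpa [IsContr] using hT
  have : Invertible (1 : Op m) := invertibleOne
  have : Invertible (1 : Op n) := invertibleOne
  have h2 := (Matrix.PosDef.fromBlocks₁₁ (A := (1 : Op m)) T (1 : Op n) Matrix.PosDef.one).2 h1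
  have h3 := (Matrix.PosDef.fromBlocks₂₂ (1 : Op m) T Matrix.PosDef.one).1 h2
  simpa [IsContr] using h3

theorem IsContr.mul {S : Matrix l m ℂ} {T : Matrix m n ℂ} (hS : IsContr S) (hT : IsContr T) :
    IsContr (S * T) := by
  have h := hT.add (hS.conjTranspose_mul_mul_same T)
  unfold IsContr
  convert h using 1
  simp only [Matrix.conjTranspose_mul, Matrix.mul_sub, Matrix.sub_mul, Matrix.mul_one,
    Matrix.mul_assoc]
  abel_nf

theorem IsContr.transpose {T : Matrix m n ℂ} (hT : IsContr T) : IsContr Tᵀ := by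
  have h := Matrix.PosSemidef.transpose hT.conjTranspose
  unfold IsContr
  have e : (1 - Tᴴᴴ * Tᴴ)ᵀ = 1 - Tᵀᴴ * Tᵀ := by
    rw [Matrix.transpose_sub, Matrix.transpose_mul, Matrix.transpose_one,
      Matrix.conjTranspose_conjTranspose]
    rfl
  rwa [e] at h

theorem IsContr.hsSq_mul_le {T : Matrix m n ℂ} (hT : IsContr T) (X : Matrix n l ℂ) :
    hsSq (T * X) ≤ hsSq X := by
  have h := re_trace_nonneg (hT.conjTranspose_mul_mul_same X)
  have e : (Xᴴ * (1 - Tᴴ * T) * X).trace = (hsSq X : ℂ) - hsSq (T * X) := by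
    rw [← trace_conjTranspose_mul_self, ← trace_conjTranspose_mul_self, ← Matrix.trace_sub]
    simp [Matrix.mul_sub, Matrix.sub_mul, Matrix.mul_assoc]
  rw [e] at h
  simpa using h

theorem IsContr.mul_hsSq_le {T : Matrix n m ℂ} (hT : IsContr T) (X : Matrix l n ℂ) :
    hsSq (X * T) ≤ hsSq X := by
  rw [← hsSq_conjTranspose, Matrix.conjTranspose_mul, ← hsSq_conjTranspose X]
  exact hT.conjTranspose.hsSq_mul_le _

theorem continuousOn_spectrum_real (f : ℝ → ℝ) (D : Op n) : ContinuousOn f (spectrum ℝ D) :=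
  (Matrix.finite_real_spectrum (A := D)).continuousOn f

theorem exists_pseudoinverse {s : Op n} (hs : s.IsHermitian) :
    ∃ N : Op n, N.IsHermitian ∧ s * N = N * s ∧ s * N * s = s := by
  have hs' : IsSelfAdjoint s := hs
  have hc : ∀ f : ℝ → ℝ, ContinuousOn f (spectrum ℝ s) := fun f => continuousOn_spectrum_real f s
  have hid : cfc (fun x : ℝ => x) s = s := cfc_id' ℝ s
  -- The convention `0⁻¹ = 0` makes this the Moore-Penrose inverse.
  refine ⟨cfc (fun x : ℝ => x⁻¹) s, cfc_predicate (R := ℝ) (fun x : ℝ => x⁻¹) s, ?_, ?_⟩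
  · conv_lhs => rw [← hid]
    conv_rhs => rw [← hid]
    rw [hid]
    nth_rewrite 1 [← hid]
    nth_rewrite 4 [← hid]
    rw [← cfc_mul _ _ s (hc _) (hc _), ← cfc_mul _ _ s (hc _) (hc _)]
    simp only [mul_comm]
  · nth_rewrite 1 [← hid]
    nth_rewrite 3 [← hid]
    rw [← cfc_mul _ _ s (hc _) (hc _), ← cfc_mul _ _ s (hc _) (hc _)]
    conv_rhs => rw [← hid]
    congr 1
    funext x
    by_cases h : x = 0 <;> simp [h]

/-- Polar decomposition of a rectangular matrix, with U = N G for N the pseudoinverse of √(GGᴴ).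
Only contractivity of U is ever needed, so no extension to an isometry is made. -/
theorem exists_contr_factor (G : Matrix n m ℂ) :
    ∃ U : Matrix n m ℂ, IsContr U ∧ G * Uᴴ = CFC.sqrt (G * Gᴴ) ∧ CFC.sqrt (G * Gᴴ) * U = G := by
  set s := CFC.sqrt (G * Gᴴ) with hs
  have hss : s * s = G * Gᴴ := sqrt_mul_sqrt (Matrix.posSemidef_self_mul_conjTranspose G)
  have hsh : sᴴ = s := conjTranspose_sqrt _
  obtain ⟨N, hN, hcomm, hsNs⟩ := exists_pseudoinverse (show s.IsHermitian from hsh)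
  have hN' : Nᴴ = N := hN
  refine ⟨N * G, ?_, ?_, ?_⟩
  · rw [← Matrix.conjTranspose_conjTranspose (N * G)]
    apply IsContr.conjTranspose
    -- N s is the support projection of s, so its complement is a projection and hence positive.
    have e : (1 : Op n) - (N * G)ᴴᴴ * (N * G)ᴴ = (1 - N * s)ᴴ * (1 - N * s) := by
      have : N * G * (Gᴴ * N) = N * s := by
        calc N * G * (Gᴴ * N) = N * (G * Gᴴ) * N := by simp only [Matrix.mul_assoc]
          _ = (N * s) * (s * N) := by rw [← hss]; simp only [Matrix.mul_assoc]
          _ = N * (s * (s * N)) := by simp only [Matrix.mul_assoc]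
          _ = N * (s * N * s) := by rw [Matrix.mul_assoc s N s, ← hcomm]
          _ = _ := by rw [hsNs]
      have h2 : s * N * (N * s) = s * N := by
        calc s * N * (N * s) = s * N * (s * N) := by rw [hcomm]
          _ = (s * N * s) * N := by simp only [Matrix.mul_assoc]
          _ = _ := by rw [hsNs]
      simp only [Matrix.conjTranspose_conjTranspose, Matrix.conjTranspose_mul,
        Matrix.conjTranspose_sub, Matrix.conjTranspose_one, hsh, hN', this]
      rw [Matrix.sub_mul, Matrix.mul_sub, Matrix.mul_sub, h2]
      simp
    unfold IsContr
    rw [e]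
    exact Matrix.posSemidef_conjTranspose_mul_self _
  · rw [Matrix.conjTranspose_mul, ← Matrix.mul_assoc, hN', ← hss, Matrix.mul_assoc, hcomm,
      ← Matrix.mul_assoc, hsNs]
  · have h0 : (1 - s * N) * G * ((1 - s * N) * G)ᴴ = 0 := by
      have : (1 - s * N) * s = 0 := by rw [Matrix.sub_mul, hsNs]; simp
      rw [Matrix.conjTranspose_mul, ← Matrix.mul_assoc, Matrix.mul_assoc (1 - s * N), ← hss,
        ← Matrix.mul_assoc, this]
      simp
    have h1 := Matrix.self_mul_conjTranspose_eq_zero.1 h0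
    rw [Matrix.sub_mul, Matrix.one_mul, sub_eq_zero] at h1
    rw [← Matrix.mul_assoc]
    exact h1.symm

end MatrixLemmas

/-! ### Trace norm, Uhlmann bounds and Powers-Størmer -/

section Fidelity

set_option linter.unusedSectionVars false

variable {n m l : Type*} [Fintype n] [Fintype m] [Fintype l]
variable [DecidableEq n] [DecidableEq m] [DecidableEq l]

theorem norm_trace_contr_mul_le {K H : Op n} (hK : IsContr K) (hH : H.PosSemidef) :
    ‖(K * H).trace‖ ≤ H.trace.re := by
  set h := CFC.sqrt H with hh
  have h1 : h * h = H := sqrt_mul_sqrt hH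
  have h2 : hᴴ = h := conjTranspose_sqrt H
  have h3 : hsSq h = H.trace.re := by
    have := trace_conjTranspose_mul_self h
    rw [h2, h1] at this
    simp [this]
  have e : (K * H).trace = (hᴴ * (K * h)).trace := by
    rw [h2, Matrix.trace_mul_comm h, Matrix.mul_assoc, h1]
  have h4 := norm_trace_conjTranspose_mul_sq_le h (K * h)
  rw [← e] at h4
  have h5 := hK.hsSq_mul_le h
  have h6 := hsSq_nonneg h
  rw [← h3]
  refine abs_le_of_sq_le_sq' ?_ h6 |>.2
  nlinarith

theorem exists_polar (C : Op n) :
    ∃ U : Op n, IsContr U ∧ U * C = CFC.sqrt (Cᴴ * C) ∧ C = Uᴴ * CFC.sqrt (Cᴴ * C) := by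
  obtain ⟨U, hU, h1, h2⟩ := exists_contr_factor Cᴴ
  rw [Matrix.conjTranspose_conjTranspose] at h1 h2
  refine ⟨U, hU, ?_, ?_⟩
  · have := congrArg Matrix.conjTranspose h1
    simpa [conjTranspose_sqrt] using this
  · have := congrArg Matrix.conjTranspose h2
    simpa [conjTranspose_sqrt] using this.symm

theorem norm_trace_mul_le_traceNorm {K : Op n} (hK : IsContr K) (C : Op n) :
    ‖(K * C).trace‖ ≤ traceNorm C := by
  obtain ⟨U, hU, -, h2⟩ := exists_polar C
  conv_lhs => rw [h2, ← mul_assoc]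
  exact norm_trace_contr_mul_le (hK.mul hU.conjTranspose) (posSemidef_sqrt _)

theorem exists_contr_trace_eq_traceNorm (C : Op n) :
    ∃ U : Op n, IsContr U ∧ (U * C).trace = (traceNorm C : ℂ) := by
  obtain ⟨U, hU, h1, -⟩ := exists_polar C
  exact ⟨U, hU, by rw [h1]; exact (ofReal_re_trace (posSemidef_sqrt _)).symm⟩

/-- The easy half of Uhlmann's theorem: R and S are purifications of R Rᴴ and S Sᴴ with arbitrary
purifying spaces, and T acts on these. The polar factors of R and S are absorbed into the
contraction. -/
theorem norm_trace_sq_le_fidelity (R : Matrix n m ℂ) (S : Matrix n l ℂ) {T : Matrix l m ℂ}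
    (hT : IsContr T) :
    ‖(Rᴴ * S * T).trace‖ ^ 2 ≤ fidelity (R * Rᴴ) (S * Sᴴ) := by
  obtain ⟨U, hU, -, hR⟩ := exists_contr_factor R
  obtain ⟨V, hV, -, hS⟩ := exists_contr_factor S
  unfold fidelity
  gcongr
  refine le_trans (le_of_eq ?_)
    (norm_trace_mul_le_traceNorm ((hV.mul hT).mul hU.conjTranspose) _)
  congr 1
  conv_lhs => rw [← hR, ← hS]
  rw [Matrix.conjTranspose_mul, conjTranspose_sqrt, Matrix.trace_mul_comm (V * T * Uᴴ),
    ← Matrix.mul_assoc (_ * _) (V * T), Matrix.trace_mul_comm _ Uᴴ]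
  simp only [Matrix.mul_assoc]

theorem fidelity_nonneg (P Q : Op n) : 0 ≤ fidelity P Q := sq_nonneg _

/-- Apply the Uhlmann bound to the purification φ with one-dimensional purifying space; the optimal
T is the normalized vector √X φ. -/
theorem dotProduct_mulVec_le_fidelity (φ : n → ℂ) {X : Op n} (hX : X.PosSemidef) :
    (star φ ⬝ᵥ (X *ᵥ φ)).re ≤ fidelity (Matrix.vecMulVec φ (star φ)) X := by
  set s := CFC.sqrt X with hs
  have h1 : s * s = X := sqrt_mul_sqrt hX
  have h2 : sᴴ = s := conjTranspose_sqrt X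
  let R : Matrix n Unit ℂ := Matrix.replicateCol Unit φ
  have hR : R * Rᴴ = Matrix.vecMulVec φ (star φ) := by
    ext i j; simp [R, Matrix.mul_apply, Matrix.vecMulVec_apply]
  have hq : (star φ ⬝ᵥ (X *ᵥ φ)) = (hsSq (s * R) : ℂ) := by
    rw [← trace_conjTranspose_mul_self, Matrix.conjTranspose_mul, h2, Matrix.mul_assoc,
      ← Matrix.mul_assoc s, h1]
    simp only [R, dotProduct, Matrix.mulVec, Matrix.trace, Matrix.mul_apply, Matrix.diag_apply,
      Finset.univ_unique, Finset.sum_singleton, Matrix.conjTranspose_apply,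
      Matrix.replicateCol_apply, Pi.star_apply]
  rw [hq, Complex.ofReal_re]
  set q := hsSq (s * R) with hqd
  have hq0 : 0 ≤ q := hsSq_nonneg _
  rcases hq0.eq_or_lt with h0 | hpos
  · rw [← h0]; exact fidelity_nonneg _ _
  let T : Matrix n Unit ℂ := ((√q)⁻¹ : ℂ) • (s * R)
  have hsq : (√q) * (√q) = q := Real.mul_self_sqrt hq0
  have hsq0 : √q ≠ 0 := (Real.sqrt_pos.2 hpos).ne'
  have hinv : (√q)⁻¹ * ((√q)⁻¹ * q) = 1 := by
    field_simp; rw [sq, hsq]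
  have hinv' : ((√q : ℂ))⁻¹ * (((√q : ℂ))⁻¹ * q) = 1 := by exact_mod_cast hinv
  have hTT : Tᴴ * T = 1 := by
    have ht := trace_conjTranspose_mul_self (s * R)
    ext i j
    have e1 : ((s * R)ᴴ * (s * R)) i j = (q : ℂ) := by
      rw [hqd, ← ht]; simp [Matrix.trace, Subsingleton.elim i (), Subsingleton.elim j ()]
    obtain rfl : i = j := Subsingleton.elim _ _
    rw [Matrix.one_apply_eq]
    simp only [T, Matrix.conjTranspose_smul, Matrix.smul_mul, Matrix.mul_smul, Matrix.smul_apply,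
      e1, smul_eq_mul]
    simpa using hinv'
  have hT : IsContr T := by
    unfold IsContr; rw [hTT, sub_self]; exact Matrix.PosSemidef.zero
  have h := norm_trace_sq_le_fidelity R s hT
  rw [hR, h2, h1] at h
  refine le_trans (le_of_eq ?_) h
  have e : (Rᴴ * s * T).trace = (√q : ℂ) := by
    have : Rᴴ * s = (s * R)ᴴ := by rw [Matrix.conjTranspose_mul, h2]
    rw [this]
    simp only [T, Matrix.mul_smul, Matrix.trace_smul, trace_conjTranspose_mul_self, smul_eq_mul,
      ← hqd]
    rw [inv_mul_eq_div, div_eq_iff (by exact_mod_cast hsq0)]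
    exact_mod_cast hsq.symm
  rw [e]
  simp [Complex.norm_real, Real.sq_sqrt hq0]

/-- A form of the Powers-Størmer inequality. -/
theorem exists_contr_trace_sqrt_mul_sqrt_ge {P Q : Op n} (hP : P.PosSemidef) (hQ : Q.PosSemidef) :
    ∃ W : Op n, IsContr W ∧ P.trace.re + Q.trace.re - (W * (P - Q)).trace.re ≤
      2 * (CFC.sqrt P * CFC.sqrt Q).trace.re := by
  set p := CFC.sqrt P
  set q := CFC.sqrt Q
  have hp : p * p = P := sqrt_mul_sqrt hP
  have hq : q * q = Q := sqrt_mul_sqrt hQ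
  set D := p - q with hD
  have hDh : IsSelfAdjoint D :=
    (posSemidef_sqrt P).isHermitian.sub (posSemidef_sqrt Q).isHermitian
  have hc : ∀ f : ℝ → ℝ, ContinuousOn f (spectrum ℝ D) := fun f => continuousOn_spectrum_real f D
  have hid : cfc (fun x : ℝ => x) D = D := cfc_id' ℝ D
  -- The value 1 at 0 makes W an involution, even when D is singular.
  let sg : ℝ → ℝ := fun x => if 0 ≤ x then 1 else -1
  set W := cfc sg D
  set M := cfc (fun x : ℝ => |x|) D
  have hWD : W * D = M := by
    have h : W * D = W * cfc (fun x : ℝ => x) D := by rw [hid]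
    rw [h, ← cfc_mul _ _ D (hc _) (hc _)]
    congr 1; funext x
    by_cases h : 0 ≤ x
    · simp [sg, h, abs_of_nonneg]
    · simp [sg, h, abs_of_neg (not_le.1 h)]
  have hDW : D * W = M := by
    have h : D * W = cfc (fun x : ℝ => x) D * W := by rw [hid]
    rw [h, ← cfc_mul _ _ D (hc _) (hc _)]
    congr 1; funext x
    by_cases h : 0 ≤ x
    · simp [sg, h, abs_of_nonneg]
    · simp [sg, h, abs_of_neg (not_le.1 h)]
  have hWh : Wᴴ = W := cfc_predicate (R := ℝ) sg D
  have hWW : W * W = 1 := by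
    rw [← cfc_mul _ _ D (hc _) (hc _), ← cfc_one ℝ D]
    congr 1; funext x
    by_cases h : 0 ≤ x <;> simp [sg, h]
  have hM1 : (M + D).PosSemidef := by
    rw [← hid, ← cfc_add D _ _ (hc _) (hc _)]
    exact Matrix.nonneg_iff_posSemidef.1 (cfc_nonneg fun x _ => by linarith [neg_abs_le x])
  have hM2 : (M - D).PosSemidef := by
    rw [← hid, ← cfc_sub _ _ D (hc _) (hc _)]
    exact Matrix.nonneg_iff_posSemidef.1 (cfc_nonneg fun x _ => by linarith [le_abs_self x])
  refine ⟨W, ?_, ?_⟩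
  · unfold IsContr; rw [hWh, hWW, sub_self]; exact Matrix.PosSemidef.zero
  -- The identity 2(p² - q²) = D(p + q) + (p + q)D turns Tr W(P - Q) into Tr |D|(p + q).
  have h2 : (2 : ℂ) • (W * (P - Q)) = W * D * (p + q) + W * (p + q) * D := by
    rw [← hp, ← hq, hD, two_smul]; noncomm_ring
  have h3 : 2 * (W * (P - Q)).trace = 2 * (M * (p + q)).trace := by
    have := congrArg Matrix.trace h2
    rw [Matrix.trace_smul, Matrix.trace_add, hWD, Matrix.trace_mul_comm (W * (p + q)) D,
      ← mul_assoc, hDW, smul_eq_mul] at this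
    rw [this]; ring
  have h3' : (W * (P - Q)).trace = (M * (p + q)).trace := mul_left_cancel₀ two_ne_zero h3
  have h4 := re_trace_mul_nonneg hM1 ((posSemidef_sqrt Q).add (posSemidef_sqrt Q))
  have h5 := re_trace_mul_nonneg hM2 ((posSemidef_sqrt P).add (posSemidef_sqrt P))
  -- Pairing |D| ± D ≥ 0 with q and p gives Tr |D|(p + q) ≥ Tr D², and Tr D² = Tr P + Tr Q - 2 Tr
  -- pq.
  have h6 : (M + D) * (q + q) + (M - D) * (p + p) =
      M * (p + q) + M * (p + q) - (p * p + q * q - p * q - q * p)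
        - (p * p + q * q - p * q - q * p) := by
    rw [hD]; noncomm_ring
  have h7 := congrArg (fun X => (Matrix.trace X).re) h6
  simp only [Matrix.trace_add, Matrix.trace_sub, Complex.add_re, Complex.sub_re] at h7 h4 h5
  rw [Matrix.trace_mul_comm q p, hp, hq] at h7
  rw [h3']
  linarith

end Fidelity

/-! ### Partial trace over the first factor -/

section PartialTrace

set_option linter.unusedSectionVars false

variable {A E : Type*} [Fintype A] [Fintype E]

/-- The partial trace over the first tensor factor. -/
def ptr : Op (A × E) →ₗ[ℂ] Op E where
  toFun X := ∑ a, X.submatrix (fun e => (a, e)) (fun e => (a, e))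
  map_add' X Y := by simp [← Finset.sum_add_distrib, Matrix.submatrix_add]
  map_smul' c X := by simp [Finset.smul_sum, Matrix.submatrix_smul]

theorem ptr_apply (X : Op (A × E)) (e e' : E) : ptr X e e' = ∑ a, X (a, e) (a, e') := by
  change (∑ a, X.submatrix (fun e => (a, e)) (fun e => (a, e))) e e' = _
  rw [Matrix.sum_apply]
  rfl

theorem posSemidef_ptr {X : Op (A × E)} (hX : X.PosSemidef) : (ptr X).PosSemidef :=
  Matrix.posSemidef_sum _ fun _ _ => hX.submatrix _

theorem conjTranspose_ptr (X : Op (A × E)) : (ptr X)ᴴ = ptr Xᴴ := by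
  ext e e'
  simp [ptr_apply, Matrix.conjTranspose_apply]

theorem trace_ptr (X : Op (A × E)) : (ptr X).trace = X.trace := by
  simp only [Matrix.trace, Matrix.diag_apply, ptr_apply, Fintype.sum_prod_type]
  exact Finset.sum_comm

variable [DecidableEq A] [DecidableEq E]

theorem one_kronecker_mul (Y : Op E) (X : Op (A × E)) (p q : A × E) :
    (((1 : Op A) ⊗ₖ Y) * X) p q = ∑ e, Y p.2 e * X (p.1, e) q := by
  simp [Matrix.mul_apply, Fintype.sum_prod_type, Matrix.one_apply, ite_mul]

theorem mul_one_kronecker (Y : Op E) (X : Op (A × E)) (p q : A × E) :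
    (X * ((1 : Op A) ⊗ₖ Y)) p q = ∑ e, X p (q.1, e) * Y e q.2 := by
  simp [Matrix.mul_apply, Fintype.sum_prod_type, Matrix.one_apply, ite_mul]

theorem ptr_one_kronecker_mul (Y : Op E) (X : Op (A × E)) :
    ptr (((1 : Op A) ⊗ₖ Y) * X) = Y * ptr X := by
  ext e e'
  rw [Matrix.mul_apply]
  simp only [ptr_apply, one_kronecker_mul, Finset.mul_sum]
  exact Finset.sum_comm

theorem ptr_mul_one_kronecker (Y : Op E) (X : Op (A × E)) :
    ptr (X * ((1 : Op A) ⊗ₖ Y)) = ptr X * Y := by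
  ext e e'
  rw [Matrix.mul_apply]
  simp only [ptr_apply, mul_one_kronecker, Finset.sum_mul]
  exact Finset.sum_comm

theorem trace_one_kronecker_mul (Y : Op E) (X : Op (A × E)) :
    (((1 : Op A) ⊗ₖ Y) * X).trace = (Y * ptr X).trace := by
  rw [← trace_ptr, ptr_one_kronecker_mul]

end PartialTrace

/-! ### Duality by first-order optimality -/

section Duality

set_option linter.unusedSectionVars false

variable {n : Type*} [Fintype n] [DecidableEq n]

theorem norm_apply_le_trace {C : Op n} (hC : C.PosSemidef) (i j : n) : ‖C i j‖ ≤ C.trace.re := by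
  have hK : IsContr (Matrix.single j i (1 : ℂ)) := by
    have e : (1 : Op n) - (Matrix.single j i (1 : ℂ))ᴴ * Matrix.single j i (1 : ℂ) =
        Matrix.diagonal (fun k => if k = i then 0 else 1) := by
      rw [Matrix.conjTranspose_single, Matrix.single_mul_single_same]
      ext a b
      by_cases hab : a = b
      · subst hab
        by_cases h : a = i
        · subst h; simp
        · simp [h, Ne.symm h]
      · simp only [Matrix.sub_apply, Matrix.one_apply_ne hab, Matrix.diagonal_apply_ne _ hab,
          Matrix.single_apply]
        rw [if_neg (by rintro ⟨rfl, rfl⟩; exact hab rfl), sub_zero]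
    unfold IsContr
    rw [e, Matrix.posSemidef_diagonal_iff]
    intro k; split_ifs <;> simp
  have h := norm_trace_contr_mul_le hK hC
  rwa [Matrix.trace_single_mul, one_smul] at h

theorem isClosed_posSemidef : IsClosed {C : Op n | C.PosSemidef} := by
  have : {C : Op n | C.PosSemidef} =
      {C : Op n | Cᴴ = C} ∩ ⋂ x : n → ℂ, {C : Op n | 0 ≤ star x ⬝ᵥ (C *ᵥ x)} := by
    ext C
    simp [Matrix.posSemidef_iff_dotProduct_mulVec, Matrix.IsHermitian]
  rw [this]
  refine (isClosed_eq (by fun_prop) continuous_id).inter (isClosed_iInter fun x => ?_)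
  exact isClosed_le continuous_const (by fun_prop)

theorem exists_smul_one_sub_posSemidef {D : Op n} (hD : D.IsHermitian) :
    ∃ c : ℝ, 0 < c ∧ ((c : ℂ) • (1 : Op n) - D).PosSemidef := by
  obtain ⟨c, hc⟩ := (Matrix.finite_real_spectrum (A := D)).bddAbove
  refine ⟨max c 1, by positivity, ?_⟩
  have hcont : ∀ f : ℝ → ℝ, ContinuousOn f (spectrum ℝ D) := fun f => continuousOn_spectrum_real f D
  have hD' : IsSelfAdjoint D := hD
  have e : ((max c 1 : ℝ) : ℂ) • (1 : Op n) - D = cfc (fun x : ℝ => max c 1 - x) D := by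
    rw [cfc_sub _ _ D (hcont _) (hcont _), cfc_id' ℝ D, cfc_const _ D]
    congr 1
    ext i j
    simp [Matrix.algebraMap_matrix_apply, Matrix.one_apply]
  rw [e]
  exact Matrix.nonneg_iff_posSemidef.1 (cfc_nonneg fun x hx =>
    sub_nonneg.2 ((hc hx).trans (le_max_left _ _)))

/-- Divide by t and let t tend to 0; this extracts the first-order condition at a maximizer. -/
theorem nonpos_of_cubic_le {b c e t₀ : ℝ} (ht₀ : 0 < t₀)
    (h : ∀ t, 0 < t → t ≤ t₀ → t * b + t ^ 2 * c + t ^ 3 * e ≤ 0) : b ≤ 0 := by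
  have h1 : Filter.Tendsto (fun t : ℝ => b + t * c + t ^ 2 * e) (nhdsWithin 0 (Set.Ioi 0))
      (nhds b) := by
    have : Continuous fun t : ℝ => b + t * c + t ^ 2 * e := by fun_prop
    simpa using (this.tendsto 0).mono_left nhdsWithin_le_nhds
  refine le_of_tendsto h1 ?_
  filter_upwards [Ioc_mem_nhdsGT ht₀] with t ht
  have := h t ht.1 ht.2
  have h2 : t * (b + t * c + t ^ 2 * e) ≤ t * 0 := by linarith
  exact le_of_mul_le_mul_left h2 ht.1

variable {A E : Type*} [Fintype A] [Fintype E] [DecidableEq A] [DecidableEq E]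

theorem isCompact_subchoi : IsCompact {C : Op (A × E) | C.PosSemidef ∧ (1 - ptr C).PosSemidef} := by
  have hb : IsCompact (Set.univ.pi fun _ : A × E => Set.univ.pi fun _ : A × E =>
      Metric.closedBall (0 : ℂ) (Fintype.card E)) :=
    isCompact_univ_pi fun _ => isCompact_univ_pi fun _ => isCompact_closedBall _ _
  refine IsCompact.of_isClosed_subset hb ?_ ?_
  · refine isClosed_posSemidef.inter (isClosed_posSemidef.preimage ?_)
    have : Continuous fun C : Op (A × E) => ptr C := by
      refine continuous_matrix fun e e' => ?_
      simp only [ptr_apply]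
      fun_prop
    fun_prop
  · rintro C ⟨h1, h2⟩ i - j -
    rw [mem_closedBall_zero_iff]
    refine (norm_apply_le_trace h1 i j).trans ?_
    have := re_trace_le h2
    rw [trace_ptr] at this
    simpa using this

/-- Strong duality for a semidefinite program. The feasible set is compact, so a maximizer C exists,
and the Lagrange multiplier is explicit: the Hermitian part of the partial trace of Cψ. Its trace is
the optimal value, and its feasibility is the first-order condition at C in the direction of an
arbitrary rank-one D. -/
theorem exists_one_kronecker_ge {ψ : Op (A × E)} (hψ : ψ.IsHermitian) {κ : ℝ}
    (h : ∀ C : Op (A × E), C.PosSemidef → (1 - ptr C).PosSemidef → (C * ψ).trace.re ≤ κ) :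
    ∃ σ : Op E, ((1 : Op A) ⊗ₖ σ - ψ).PosSemidef ∧ σ.trace.re ≤ κ := by
  obtain ⟨C, ⟨hC, hC1⟩, hmax⟩ := (isCompact_subchoi (A := A) (E := E)).exists_isMaxOn
    ⟨0, Matrix.PosSemidef.zero, by simpa using Matrix.PosSemidef.one⟩
    (f := fun C : Op (A × E) => (C * ψ).trace.re)
    (Complex.continuous_re.comp (by fun_prop)).continuousOn
  have hψ' : ψᴴ = ψ := hψ
  have hC' : Cᴴ = C := hC.isHermitian
  set σ : Op E := (1 / 2 : ℂ) • (ptr (C * ψ) + ptr (ψ * C)) with hσ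
  have hσh : σᴴ = σ := by
    simp only [hσ, Matrix.conjTranspose_smul, Matrix.conjTranspose_add, conjTranspose_ptr,
      Matrix.conjTranspose_mul, hψ', hC']
    rw [add_comm]; simp
  refine ⟨σ, ?_, ?_⟩
  swap
  · have : σ.trace = (C * ψ).trace := by
      simp only [hσ, Matrix.trace_smul, Matrix.trace_add, trace_ptr, Matrix.trace_mul_comm ψ C,
        smul_eq_mul]
      ring
    rw [this]; exact h C hC hC1
  have hH : ((1 : Op A) ⊗ₖ σ - ψ).IsHermitian := by
    unfold Matrix.IsHermitian
    rw [Matrix.conjTranspose_sub, Matrix.conjTranspose_kronecker, hσh, hψ',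
      Matrix.conjTranspose_one]
  refine Matrix.PosSemidef.of_dotProduct_mulVec_nonneg hH fun v => ?_
  set D : Op (A × E) := Matrix.vecMulVec v (star v) with hDdef
  have hD : D.PosSemidef := Matrix.posSemidef_vecMulVec_self_star v
  set δ : Op E := ptr D
  have hδ : δ.PosSemidef := posSemidef_ptr hD
  have hδ' : δᴴ = δ := hδ.isHermitian
  obtain ⟨c, hc0, hc⟩ := exists_smul_one_sub_posSemidef hδ.isHermitian
  set d : Op (A × E) := (1 : Op A) ⊗ₖ δ
  have hkey : (D * ψ).trace.re - (δ * σ).trace.re ≤ 0 := by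
    refine nonpos_of_cubic_le (t₀ := 3 / c)
      (c := ((-(1 / 2 : ℂ)) • (d * D * ψ + D * d * ψ) + (1 / 4 : ℂ) • (d * C * d * ψ)).trace.re)
      (e := ((1 / 4 : ℂ) • (d * D * d * ψ)).trace.re) (by positivity) fun t ht htc => ?_
    -- Conjugation by z restores feasibility of C + tD: z(1 + tδ)z = 1 - (t²/4) δ(3 - tδ)δ, which is
    -- at most 1 as long as tδ ≤ 3. Hence the range t ≤ 3/c.
    set z : Op E := 1 - ((t / 2 : ℝ) : ℂ) • δ with hz
    set Z : Op (A × E) := (1 : Op A) ⊗ₖ z with hZ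
    have hz' : zᴴ = z := by simp [hz, hδ']
    have hZ' : Zᴴ = Z := by
      rw [hZ, Matrix.conjTranspose_kronecker, hz', Matrix.conjTranspose_one]
    have ht0 : (0 : ℂ) ≤ (t : ℂ) := by exact_mod_cast ht.le
    have hCt : (Z * (C + (t : ℂ) • D) * Z).PosSemidef := by
      have := (hC.add (hD.smul ht0)).mul_mul_conjTranspose_same Z
      rwa [hZ'] at this
    have hpt : ptr (Z * (C + (t : ℂ) • D) * Z) = z * (ptr C + (t : ℂ) • δ) * z := by
      rw [hZ, ptr_mul_one_kronecker, ptr_one_kronecker_mul, map_add, map_smul]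
    have h3 : ((3 : ℂ) • (1 : Op E) - (t : ℂ) • δ).PosSemidef := by
      have hct : 0 ≤ 3 - t * c := by
        have := (le_div_iff₀ hc0).1 htc
        linarith
      have hct' : (0 : ℂ) ≤ ((3 - t * c : ℝ) : ℂ) := by exact_mod_cast hct
      have h4 := (hc.smul ht0).add ((Matrix.PosSemidef.one (n := E) (R := ℂ)).smul hct')
      convert h4 using 1
      push_cast
      module
    have hle : (1 - ptr (Z * (C + (t : ℂ) • D) * Z)).PosSemidef := by
      have h5 := hC1.mul_mul_conjTranspose_same z
      have h6 := (h3.mul_mul_conjTranspose_same δ).smul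
        (show (0 : ℂ) ≤ ((t ^ 2 / 4 : ℝ) : ℂ) by exact_mod_cast (by positivity : 0 ≤ t ^ 2 / 4))
      rw [hpt]
      convert h5.add h6 using 1
      rw [hz', hδ', hz]
      push_cast
      simp only [sub_mul, mul_sub, mul_add, add_mul, smul_mul_assoc, mul_smul_comm, one_mul,
        mul_one, mul_assoc]
      module
    have hm : (Z * (C + (t : ℂ) • D) * Z * ψ).trace.re ≤ (C * ψ).trace.re := hmax ⟨hCt, hle⟩
    have hZd : Z = 1 - ((t / 2 : ℝ) : ℂ) • d := by
      rw [hZ, hz, sub_eq_add_neg, Matrix.kronecker_add, ← neg_smul, Matrix.kronecker_smul,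
        Matrix.one_kronecker_one, neg_smul, ← sub_eq_add_neg]
    have hex : Z * (C + (t : ℂ) • D) * Z * ψ = C * ψ +
        (t : ℂ) • (D * ψ - (1 / 2 : ℂ) • (d * (C * ψ) + C * (d * ψ))) +
        ((t ^ 2 : ℝ) : ℂ) • ((-(1 / 2 : ℂ)) • (d * D * ψ + D * d * ψ)
          + (1 / 4 : ℂ) • (d * C * d * ψ)) +
        ((t ^ 3 : ℝ) : ℂ) • ((1 / 4 : ℂ) • (d * D * d * ψ)) := by
      rw [hZd]
      push_cast
      simp only [sub_mul, mul_sub, mul_add, add_mul, smul_mul_assoc, mul_smul_comm, one_mul,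
        mul_one, mul_assoc]
      module
    have hlin : (D * ψ - (1 / 2 : ℂ) • (d * (C * ψ) + C * (d * ψ))).trace =
        (D * ψ).trace - (δ * σ).trace := by
      have e1 : (C * (d * ψ)).trace = (d * (ψ * C)).trace := by
        rw [Matrix.trace_mul_comm, mul_assoc]
      rw [Matrix.trace_sub, Matrix.trace_smul, Matrix.trace_add, e1, trace_one_kronecker_mul,
        trace_one_kronecker_mul, hσ, mul_smul_comm, Matrix.trace_smul, mul_add, Matrix.trace_add]
    rw [hex] at hm
    rw [Matrix.trace_add, Matrix.trace_add, Matrix.trace_add, Matrix.trace_smul (t : ℂ), hlin,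
      Matrix.trace_smul ((t ^ 2 : ℝ) : ℂ), Matrix.trace_smul ((t ^ 3 : ℝ) : ℂ)] at hm
    simp only [smul_eq_mul, Complex.add_re, Complex.re_ofReal_mul, Complex.sub_re] at hm
    linarith
  have e2 : star v ⬝ᵥ (((1 : Op A) ⊗ₖ σ - ψ) *ᵥ v) = (δ * σ).trace - (D * ψ).trace := by
    have e3 : (δ * σ).trace = (D * ((1 : Op A) ⊗ₖ σ)).trace := by
      rw [← trace_ptr (D * _), ptr_mul_one_kronecker]
    rw [e3, ← Matrix.trace_sub, ← mul_sub, hDdef, Matrix.vecMulVec_mul,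
      Matrix.trace_vecMulVec, Matrix.dotProduct_mulVec, dotProduct_comm]
  have e4 := hH.im_star_dotProduct_mulVec_self v
  rw [Complex.le_def]
  refine ⟨?_, by simpa using e4.symm⟩
  rw [e2]
  simp only [Complex.zero_re, Complex.sub_re]
  linarith

end Duality

/-! ### From the fidelity bound to a weighted Hilbert-Schmidt bound -/

section Collision

set_option linter.unusedSectionVars false

variable {A B E : Type*} [Fintype A] [DecidableEq A] [Fintype B] [DecidableEq B]
  [Fintype E] [DecidableEq E]

/-- The vector `R` on `(A × B) × E`, seen as an operator from `B` to `A × E`. -/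
def reshape (R : Matrix (A × B) E ℂ) : Matrix (A × E) B ℂ := fun p b => R (p.1, b) p.2

theorem hsSq_reshape (R : Matrix (A × B) E ℂ) : hsSq (reshape R) = hsSq R := by
  simp only [hsSq, reshape, Fintype.sum_prod_type]
  exact Finset.sum_congr rfl fun _ _ => Finset.sum_comm

theorem ptr_reshape (R : Matrix (A × B) E ℂ) :
    ptr (reshape R * (reshape R)ᴴ) = Rᵀ * Rᵀᴴ := by
  ext e e'
  simp only [ptr_apply, Matrix.mul_apply, reshape, Matrix.conjTranspose_apply,
    Matrix.transpose_apply, Fintype.sum_prod_type]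

theorem hsSq_smul {m n : Type*} [Fintype m] [Fintype n] (c : ℝ) (X : Matrix m n ℂ) :
    hsSq ((c : ℂ) • X) = c ^ 2 * hsSq X := by
  simp [hsSq, Finset.mul_sum, mul_pow]

theorem hsSq_transpose {m n : Type*} [Fintype m] [Fintype n] (X : Matrix m n ℂ) :
    hsSq Xᵀ = hsSq X := by
  unfold hsSq; rw [Finset.sum_comm]; rfl

/-- A feasible C yields a competitor for the fidelity: with V = √C applied to the purification, the
normalized V gives a state on B, and √C with its indices regrouped is a contraction on the purifying
side. The resulting Uhlmann overlap is √q with q = Tr Cψ, so the fidelity is at least q. -/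
theorem re_trace_mul_reshape_le {R : Matrix (A × B) E ℂ} {κ : ℝ} (hκ : 0 ≤ κ)
    (h : ∀ σ : Op B, IsState σ → fidelity (R * Rᴴ) ((1 : Op A) ⊗ₖ σ) ≤ κ)
    {C : Op (A × E)} (hC : C.PosSemidef) (hC1 : (1 - ptr C).PosSemidef) :
    (C * (reshape R * (reshape R)ᴴ)).trace.re ≤ κ := by
  set s := CFC.sqrt C with hs
  have hss : s * s = C := sqrt_mul_sqrt hC
  have hsh : sᴴ = s := conjTranspose_sqrt C
  set V : Matrix (A × E) B ℂ := s * reshape R with hV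
  have hq : (C * (reshape R * (reshape R)ᴴ)).trace = (hsSq V : ℂ) := by
    rw [← trace_mul_conjTranspose_self, hV, Matrix.conjTranspose_mul, hsh, ← hss,
      Matrix.mul_assoc s s, Matrix.trace_mul_comm s]
    simp only [Matrix.mul_assoc]
  rw [hq, Complex.ofReal_re]
  set q := hsSq V with hqd
  have hq0 : 0 ≤ q := hsSq_nonneg V
  rcases hq0.eq_or_lt with h0 | hpos
  · rwa [← h0]
  have hsq : √q * √q = q := Real.mul_self_sqrt hq0
  have hsq0 : √q ≠ 0 := (Real.sqrt_pos.2 hpos).ne'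
  set V' : Matrix B (A × E) ℂ := (((√q)⁻¹ : ℝ) : ℂ) • Vᵀ with hV'
  have hstate : IsState (V' * V'ᴴ) := by
    refine ⟨Matrix.posSemidef_self_mul_conjTranspose _, ?_⟩
    rw [trace_mul_conjTranspose_self, hV', hsSq_smul, hsSq_transpose, ← hqd]
    norm_cast
    rw [inv_pow, sq, hsq, inv_mul_cancel₀ hpos.ne']
  -- Chosen so that TᴴT is the transpose of the partial trace of C, whence feasibility of C is
  -- contractivity of T.
  obtain ⟨T, hTa⟩ : ∃ T : Matrix (A × (A × E)) E ℂ, ∀ p e, T p e = star (s p.2 (p.1, e)) :=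
    ⟨fun p e => star (s p.2 (p.1, e)), fun _ _ => rfl⟩
  have hT : IsContr T := by
    have e1 : 1 - Tᴴ * T = (1 - ptr C)ᵀ := by
      rw [Matrix.transpose_sub, Matrix.transpose_one, ← hss]
      congr 1
      ext e e'
      rw [Matrix.transpose_apply, ptr_apply, Matrix.mul_apply, Fintype.sum_prod_type]
      refine Finset.sum_congr rfl fun a _ => ?_
      nth_rewrite 1 [← hsh]
      rw [Matrix.mul_apply]
      refine Finset.sum_congr rfl fun k _ => ?_
      rw [Matrix.conjTranspose_apply, Matrix.conjTranspose_apply, hTa, hTa, star_star, mul_comm]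
    unfold IsContr
    rw [e1]
    exact hC1.transpose
  have hfid := norm_trace_sq_le_fidelity R ((1 : Op A) ⊗ₖ V') hT
  have e2 : ((1 : Op A) ⊗ₖ V') * ((1 : Op A) ⊗ₖ V')ᴴ = (1 : Op A) ⊗ₖ (V' * V'ᴴ) := by
    rw [Matrix.conjTranspose_kronecker, ← Matrix.mul_kronecker_mul, Matrix.conjTranspose_one,
      one_mul]
  rw [e2] at hfid
  refine le_trans (le_of_eq ?_) (hfid.trans (h _ hstate))
  have e3 : (Rᴴ * ((1 : Op A) ⊗ₖ V') * T).trace = (√q : ℂ) := by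
    have e4 : (Rᴴ * ((1 : Op A) ⊗ₖ V') * T).trace = (((√q)⁻¹ : ℝ) : ℂ) * (Vᴴ * V).trace := by
      rw [Matrix.mul_assoc, trace_conjTranspose_mul, trace_conjTranspose_mul]
      have e5 : ∀ a b e, (((1 : Op A) ⊗ₖ V') * T) (a, b) e =
          ∑ k, V' b k * star (s k (a, e)) := by
        intro a b e
        rw [Matrix.mul_apply, Fintype.sum_prod_type]
        simp only [hTa, Matrix.kroneckerMap_apply, Matrix.one_apply, ite_mul, one_mul, zero_mul]
        rw [Finset.sum_eq_single a (fun a' _ h => by simp [Ne.symm h]) (by simp)]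
        simp
      have e6 : ∀ k b, star (V k b) = ∑ a, ∑ e, star (s k (a, e)) * star (R (a, b) e) := by
        intro k b
        rw [hV, Matrix.mul_apply, Fintype.sum_prod_type]
        simp only [star_sum, star_mul', reshape]
      have e7 : ∀ b k, V' b k = (((√q)⁻¹ : ℝ) : ℂ) * V k b := fun _ _ => rfl
      simp only [e6]
      rw [Fintype.sum_prod_type]
      simp only [e5, e7, Finset.mul_sum, Finset.sum_mul]
      rw [Finset.sum_comm]
      conv_rhs => rw [Finset.sum_comm]
      refine Finset.sum_congr rfl fun b _ => ?_
      conv_rhs => rw [Finset.sum_comm]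
      refine Finset.sum_congr rfl fun a _ => ?_
      conv_rhs => rw [Finset.sum_comm]
      refine Finset.sum_congr rfl fun e _ => Finset.sum_congr rfl fun k _ => ?_
      ring
    rw [e4, trace_conjTranspose_mul_self, ← hqd, ← Complex.ofReal_mul]
    congr 1
    field_simp
    rw [sq, hsq]
  rw [e3, Complex.norm_real, Real.norm_eq_abs, sq_abs, Real.sq_sqrt hq0]

/-- From ψ ≤ 1 ⊗ s² it follows that (reshape R)ᴴ(1 ⊗ s⁻¹) is a contraction, so weighting ψ by s⁻¹
leaves a Hilbert-Schmidt norm no larger than that of R. -/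
theorem exists_collision_bound [Nonempty A] {R : Matrix (A × B) E ℂ} {κ κ' : ℝ} (hκ : 0 ≤ κ)
    (hκ' : κ < κ') (h : ∀ σ : Op B, IsState σ → fidelity (R * Rᴴ) ((1 : Op A) ⊗ₖ σ) ≤ κ) :
    ∃ s N : Op E, N * s = 1 ∧ hsSq s ≤ κ' ∧
      hsSq (reshape R * (reshape R)ᴴ * ((1 : Op A) ⊗ₖ N)) ≤ hsSq R := by
  set ψ := reshape R * (reshape R)ᴴ with hψd
  have hψ : ψ.PosSemidef := Matrix.posSemidef_self_mul_conjTranspose _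
  obtain ⟨σ, hσ, htr⟩ := exists_one_kronecker_ge hψ.isHermitian
    fun C hC hC1 => re_trace_mul_reshape_le hκ h hC hC1
  -- σ is a diagonal block of 1 ⊗ σ ≥ ψ ≥ 0; this uses that A is nonempty.
  have hσ0 : σ.PosSemidef := by
    have h1 := hσ.add hψ
    rw [sub_add_cancel] at h1
    obtain ⟨a⟩ := ‹Nonempty A›
    have h2 := h1.submatrix (fun e : E => (a, e))
    convert h2 using 1
    ext i j
    simp
  -- Adding c times the identity makes σ invertible at a trace cost of at most κ' - κ.
  set c : ℝ := (κ' - κ) / (Fintype.card E + 1)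
  have hc : 0 < c := div_pos (by linarith) (by positivity)
  have hcE : c * Fintype.card E ≤ κ' - κ := by
    have : c * (Fintype.card E + 1) = κ' - κ := div_mul_cancel₀ _ (by positivity)
    linarith
  set σ' : Op E := σ + (c : ℂ) • 1
  have hcC : (0 : ℂ) < (c : ℂ) := by exact_mod_cast hc
  have hσ' : σ'.PosDef := Matrix.PosDef.posSemidef_add hσ0 (Matrix.PosDef.one.smul hcC)
  set s := CFC.sqrt σ' with hs
  have hss : s * s = σ' := sqrt_mul_sqrt hσ'.posSemidef
  have hsh : sᴴ = s := conjTranspose_sqrt σ'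
  have hsu : IsUnit s.det := by
    have h1 : IsUnit (s * s).det := by rw [hss]; exact (Matrix.isUnit_iff_isUnit_det _).1 hσ'.isUnit
    rw [Matrix.det_mul] at h1
    exact isUnit_of_mul_isUnit_left h1
  have hNh : s⁻¹ᴴ = s⁻¹ := by rw [Matrix.conjTranspose_nonsing_inv, hsh]
  refine ⟨s, s⁻¹, Matrix.nonsing_inv_mul _ hsu, ?_, ?_⟩
  · have h1 := trace_conjTranspose_mul_self s
    rw [hsh, hss] at h1
    have h2 : hsSq s = σ'.trace.re := by rw [h1]; simp
    rw [h2, Matrix.trace_add, Matrix.trace_smul, Matrix.trace_one]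
    simp only [smul_eq_mul, Complex.add_re, Complex.re_ofReal_mul, Complex.natCast_re]
    linarith
  set Ns : Op (A × E) := (1 : Op A) ⊗ₖ s⁻¹ with hNs
  have hNsh : Nsᴴ = Ns := by rw [hNs, Matrix.conjTranspose_kronecker, hNh, Matrix.conjTranspose_one]
  have hK : IsContr ((reshape R)ᴴ * Ns) := by
    have h1 : ((1 : Op A) ⊗ₖ σ' - ψ).PosSemidef := by
      have h2 : ((c : ℂ) • (1 : Op (A × E))).PosSemidef := Matrix.PosSemidef.one.smul hcC.le
      convert hσ.add h2 using 1
      rw [Matrix.kronecker_add, Matrix.kronecker_smul, Matrix.one_kronecker_one]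
      abel
    have h3 := h1.mul_mul_conjTranspose_same Ns
    unfold IsContr
    convert h3 using 1
    rw [hNsh, Matrix.mul_sub, Matrix.sub_mul, Matrix.conjTranspose_mul, hNsh,
      Matrix.conjTranspose_conjTranspose]
    congr 1
    · rw [hNs, ← Matrix.mul_kronecker_mul, ← Matrix.mul_kronecker_mul, ← hss,
        ← Matrix.mul_assoc, Matrix.nonsing_inv_mul _ hsu, one_mul, one_mul, one_mul,
        Matrix.mul_nonsing_inv _ hsu, Matrix.one_kronecker_one]
    · simp only [hψd, Matrix.mul_assoc]
  rw [hψd, Matrix.mul_assoc, ← hsSq_reshape R]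
  exact hK.mul_hsSq_le _

end Collision

/-! ### Second moments of random third roots of unity -/

section RandomPhases

/-- A random third root of unity, one for each index in `P`. -/
def phase {P : Type*} (x : P → ZMod 3) (p : P) : ℂ := ZMod.stdAddChar (x p)

variable {P : Type*} [Fintype P] [DecidableEq P]

theorem star_phase {P : Type*} (x : P → ZMod 3) (p : P) :
    star (phase x p) = ZMod.stdAddChar (-x p) := by
  rw [AddChar.map_neg_eq_conj]; rfl

theorem sum_stdAddChar_hom_eq_zero (f : (P → ZMod 3) → ZMod 3)
    (hf : ∀ x y, f (x + y) = f x + f y) (x : P → ZMod 3) (hx : f x ≠ 0) :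
    ∑ x, (ZMod.stdAddChar (f x) : ℂ) = 0 := by
  have h : (ZMod.stdAddChar : AddChar (ZMod 3) ℂ).compAddMonoidHom (AddMonoidHom.mk' f hf) ≠ 0 := by
    intro h0
    have h1 := congrArg (fun χ : AddChar (P → ZMod 3) ℂ => χ x) h0
    simp only [AddChar.compAddMonoidHom_apply, AddChar.zero_apply, AddMonoidHom.mk'_apply] at h1
    refine hx (ZMod.injective_stdAddChar ?_)
    rw [h1, AddChar.map_zero_eq_one]
  exact AddChar.sum_eq_zero_iff_ne_zero.2 h

theorem phase_mul_star_self {P : Type*} (x : P → ZMod 3) (p : P) :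
    phase x p * star (phase x p) = 1 := by
  rw [star_phase, phase, ← AddChar.map_add_eq_mul, add_neg_cancel, AddChar.map_zero_eq_one]

theorem sum_star_phase_mul_phase (p q : P) :
    ∑ x : P → ZMod 3, star (phase x p) * phase x q =
      if p = q then (Fintype.card (P → ZMod 3) : ℂ) else 0 := by
  split_ifs with h
  · subst h
    simp only [mul_comm (star _), phase_mul_star_self]
    simp
  · simp only [star_phase]
    simp only [phase, ← AddChar.map_add_eq_mul]
    refine sum_stdAddChar_hom_eq_zero (fun x => -x p + x q)
      (fun x y => by simp only [Pi.add_apply]; ring) (Pi.single q 1) ?_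
    simp [h]

/-- Distinct ordered pairs give distinct characters of (ℤ/3)^P. Random signs would not do: they
identify (p, q) with (q, p). -/
theorem sum_phase_pairs {p q p' q' : P} (hpq : p ≠ q) (hpq' : p' ≠ q') :
    ∑ x : P → ZMod 3, (phase x p * star (phase x q)) * star (phase x p' * star (phase x q')) =
      if p = p' ∧ q = q' then (Fintype.card (P → ZMod 3) : ℂ) else 0 := by
  split_ifs with h
  · obtain ⟨rfl, rfl⟩ := h
    have : ∀ x : P → ZMod 3,
        (phase x p * star (phase x q)) * star (phase x p * star (phase x q)) = 1 := by
      intro x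
      rw [star_mul', star_star, mul_mul_mul_comm, phase_mul_star_self, mul_comm (star _),
        phase_mul_star_self, one_mul]
    simp only [this]
    simp
  · simp only [star_mul', star_star]
    simp only [star_phase]
    simp only [phase, ← AddChar.map_add_eq_mul]
    by_cases hp : p = p'
    · subst hp
      have hq : q ≠ q' := fun hq => h ⟨rfl, hq⟩
      refine sum_stdAddChar_hom_eq_zero (fun x => x p + -x q + (-x p + x q'))
        (fun x y => by simp only [Pi.add_apply]; ring) (Pi.single q 1) ?_
      simp [hpq, hq.symm]
    · refine sum_stdAddChar_hom_eq_zero (fun x => x p + -x q + (-x p' + x q'))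
        (fun x y => by simp only [Pi.add_apply]; ring) (Pi.single p 1) ?_
      by_cases hq : q' = p
      -- Here the tested coefficient is 1 + 1, which is nonzero modulo 3.
      · subst hq
        simp [hpq.symm, hpq']
        decide
      · simp [hpq.symm, Ne.symm hp, hq]

/-- Parseval's identity. Orthogonality is required only on the support of c, because the pairs with
equal phase indices are not orthogonal to one another. -/
theorem sum_norm_sq_eq {Ω U : Type*} [Fintype Ω] [Fintype U] [DecidableEq U] (χ : U → Ω → ℂ)
    (c : U → ℂ) (N : ℝ)
    (h : ∀ u v, c u ≠ 0 → c v ≠ 0 →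
      ∑ x, χ u x * star (χ v x) = if u = v then (N : ℂ) else 0) :
    ∑ x, ‖∑ u, c u * χ u x‖ ^ 2 = N * ∑ u, ‖c u‖ ^ 2 := by
  have h1 : ((∑ x, ‖∑ u, c u * χ u x‖ ^ 2 : ℝ) : ℂ) =
      ∑ u, ∑ v, c u * star (c v) * ∑ x, χ u x * star (χ v x) := by
    have h0 : ∀ x, ((‖∑ u, c u * χ u x‖ ^ 2 : ℝ) : ℂ) =
        ∑ u, ∑ v, (c u * χ u x) * star (c v * χ v x) := by
      intro x
      rw [← Finset.sum_mul_sum, ← star_sum]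
      push_cast
      exact (Complex.mul_conj' _).symm
    rw [Complex.ofReal_sum]
    simp only [h0, Finset.mul_sum]
    rw [Finset.sum_comm]
    refine Finset.sum_congr rfl fun u _ => ?_
    rw [Finset.sum_comm]
    refine Finset.sum_congr rfl fun v _ => Finset.sum_congr rfl fun x _ => ?_
    rw [star_mul']
    ring
  have h2 : ∀ u v, c u * star (c v) * ∑ x, χ u x * star (χ v x) =
      if u = v then (N : ℂ) * ((‖c u‖ ^ 2 : ℝ) : ℂ) else 0 := by
    intro u v
    by_cases hu : c u = 0
    · simp [hu]
    by_cases hv : c v = 0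
    · simp only [hv, star_zero, mul_zero, zero_mul]
      rw [eq_comm]
      refine ite_eq_right_iff.2 fun huv => absurd (huv ▸ hv) hu
    rw [h u v hu hv]
    split_ifs with huv
    · subst huv
      push_cast
      rw [← Complex.mul_conj']
      simp only [RCLike.star_def]
      ring
    · simp
  simp only [h2, Finset.sum_ite_eq, Finset.mem_univ, if_true, ← Finset.mul_sum] at h1
  exact_mod_cast h1

variable {A I : Type*} [Fintype A] [DecidableEq A] [Fintype I] [DecidableEq I]

/-- The random matrix whose entries are independent third roots of unity. -/
def phaseMatrix (x : I × A → ZMod 3) : Matrix I A ℂ := fun i a => phase x (i, a)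

theorem sum_phaseMatrix : ∑ x : I × A → ZMod 3, (phaseMatrix x)ᴴ * phaseMatrix x =
    ((Fintype.card (I × A → ZMod 3) * Fintype.card I : ℝ) : ℂ) • 1 := by
  ext a a'
  rw [Matrix.sum_apply]
  simp only [Matrix.mul_apply, Matrix.conjTranspose_apply, phaseMatrix]
  rw [Finset.sum_comm]
  simp only [sum_star_phase_mul_phase]
  by_cases h : a = a'
  · subst h
    simp [mul_comm]
  · simp [h]

/-- Subtracting the trace removes exactly the terms whose two phases cancel; the remaining ones are
orthogonal. -/
theorem sum_norm_sq_phase_sub_le (y : Matrix A A ℂ) (i j : I) :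
    ∑ x : I × A → ZMod 3,
      ‖(phaseMatrix x * y * (phaseMatrix x)ᴴ) i j - (1 : Op I) i j * y.trace‖ ^ 2 =
    Fintype.card (I × A → ZMod 3) *
      ∑ u : A × A, ‖if (i, u.1) = (j, u.2) then 0 else y u.1 u.2‖ ^ 2 := by
  rw [← sum_norm_sq_eq (fun (u : A × A) (x : I × A → ZMod 3) =>
    phase x (i, u.1) * star (phase x (j, u.2)))]
  · refine Finset.sum_congr rfl fun x _ => ?_
    congr 2
    have h1 : (phaseMatrix x * y * (phaseMatrix x)ᴴ) i j =
        ∑ u : A × A, y u.1 u.2 * (phase x (i, u.1) * star (phase x (j, u.2))) := by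
      simp only [Matrix.mul_apply, Matrix.conjTranspose_apply, phaseMatrix, Finset.sum_mul]
      rw [Fintype.sum_prod_type, Finset.sum_comm]
      refine Finset.sum_congr rfl fun _ _ => Finset.sum_congr rfl fun _ _ => ?_
      ring
    have h2 : (1 : Op I) i j * y.trace = ∑ u : A × A,
        (if (i, u.1) = (j, u.2) then y u.1 u.2 else 0) *
          (phase x (i, u.1) * star (phase x (j, u.2))) := by
      by_cases hij : i = j
      · subst hij
        rw [Fintype.sum_prod_type]
        rw [Matrix.one_apply_eq, one_mul]
        refine Finset.sum_congr rfl fun a _ => ?_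
        rw [Finset.sum_eq_single a (fun a' _ h => by simp [Ne.symm h]) (by simp)]
        rw [if_pos rfl, phase_mul_star_self, mul_one, Matrix.diag_apply]
      · simp [hij]
    rw [h1, h2, ← Finset.sum_sub_distrib]
    refine Finset.sum_congr rfl fun u _ => ?_
    split_ifs <;> ring
  · intro u v hu hv
    have hu' : (i, u.1) ≠ (j, u.2) := fun h => hu (by simp [h])
    have hv' : (i, v.1) ≠ (j, v.2) := fun h => hv (by simp [h])
    rw [sum_phase_pairs hu' hv']
    simp [Prod.ext_iff]

variable {E : Type*} [Fintype E] [DecidableEq E]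

theorem kronecker_one_conj_apply (M : Matrix I A ℂ) (Y : Op (A × E)) (i j : I) (e e' : E) :
    ((M ⊗ₖ (1 : Op E)) * Y * (M ⊗ₖ (1 : Op E))ᴴ) (i, e) (j, e') =
      (M * (Y.submatrix (fun a => (a, e)) (fun a => (a, e'))) * Mᴴ) i j := by
  rw [Matrix.conjTranspose_kronecker, Matrix.conjTranspose_one]
  simp [Matrix.mul_apply, Fintype.sum_prod_type, Matrix.one_apply, ite_mul, mul_ite]

/-- The decoupling estimate. Conjugation by M ⊗ 1 acts separately on each E-block of Y, so the
scalar variance is summed over blocks, and the d² pairs (i, j) account for the factor. -/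
theorem sum_hsSq_phaseMatrix_sub_le (Y : Op (A × E)) :
    ∑ x : I × A → ZMod 3, hsSq ((phaseMatrix x ⊗ₖ (1 : Op E)) * Y *
        (phaseMatrix x ⊗ₖ (1 : Op E))ᴴ - (1 : Op I) ⊗ₖ ptr Y) ≤
      Fintype.card (I × A → ZMod 3) * (Fintype.card I) ^ 2 * hsSq Y := by
  have h1 : ∀ i j e e', ∑ x : I × A → ZMod 3, ‖((phaseMatrix x ⊗ₖ (1 : Op E)) * Y *
        (phaseMatrix x ⊗ₖ (1 : Op E))ᴴ - (1 : Op I) ⊗ₖ ptr Y) (i, e) (j, e')‖ ^ 2 ≤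
      Fintype.card (I × A → ZMod 3) * ∑ a, ∑ a', ‖Y (a, e) (a', e')‖ ^ 2 := by
    intro i j e e'
    have h2 := sum_norm_sq_phase_sub_le (Y.submatrix (fun a => (a, e)) (fun a => (a, e'))) i j
    have h3 : (Y.submatrix (fun a => (a, e)) (fun a => (a, e'))).trace = ptr Y e e' := by
      rw [ptr_apply]; rfl
    simp only [Matrix.sub_apply, kronecker_one_conj_apply, Matrix.kroneckerMap_apply]
    rw [← h3, h2, Fintype.sum_prod_type]
    gcongr with a _ a' _
    split_ifs <;> simp
  simp only [hsSq, Fintype.sum_prod_type]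
  calc _ = ∑ i : I, ∑ e, ∑ j : I, ∑ e', ∑ x : I × A → ZMod 3,
        ‖((phaseMatrix x ⊗ₖ (1 : Op E)) * Y *
        (phaseMatrix x ⊗ₖ (1 : Op E))ᴴ - (1 : Op I) ⊗ₖ ptr Y) (i, e) (j, e')‖ ^ 2 := by
        rw [Finset.sum_comm]
        refine Finset.sum_congr rfl fun i _ => ?_
        rw [Finset.sum_comm]
        refine Finset.sum_congr rfl fun e _ => ?_
        rw [Finset.sum_comm]
        refine Finset.sum_congr rfl fun j _ => ?_
        rw [Finset.sum_comm]
    _ ≤ ∑ i : I, ∑ e, ∑ j : I, ∑ e',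
        Fintype.card (I × A → ZMod 3) * ∑ a, ∑ a', ‖Y (a, e) (a', e')‖ ^ 2 := by
        gcongr with i _ e _ j _ e' _
        exact h1 i j e e'
    _ = _ := by
        simp only [Finset.sum_const, Finset.card_univ, nsmul_eq_mul, ← Finset.mul_sum]
        have : ∑ e, ∑ e', ∑ a, ∑ a', ‖Y (a, e) (a', e')‖ ^ 2 =
            ∑ a, ∑ e, ∑ a', ∑ e', ‖Y (a, e) (a', e')‖ ^ 2 := by
          have hr : ∀ e, ∑ e', ∑ a, ∑ a', ‖Y (a, e) (a', e')‖ ^ 2 =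
              ∑ a, ∑ a', ∑ e', ‖Y (a, e) (a', e')‖ ^ 2 := by
            intro e
            rw [Finset.sum_comm]
            exact Finset.sum_congr rfl fun a _ => Finset.sum_comm
          rw [Finset.sum_congr rfl fun e _ => hr e, Finset.sum_comm]
        rw [this]
        ring

end RandomPhases

/-! ### Bob's decoders from decoupling -/

section Decoder

set_option linter.unusedSectionVars false

variable {A B E I : Type*} [Fintype A] [DecidableEq A] [Fintype B] [DecidableEq B]
  [Fintype E] [DecidableEq E] [Fintype I] [DecidableEq I]

theorem hsSq_one_kronecker {m n : Type*} [Fintype m] [Fintype n] [DecidableEq m] [DecidableEq n]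
    (X : Matrix m n ℂ) :
    hsSq ((1 : Op I) ⊗ₖ X) = Fintype.card I * hsSq X := by
  have h := trace_mul_conjTranspose_self ((1 : Op I) ⊗ₖ X)
  rw [Matrix.conjTranspose_kronecker, ← Matrix.mul_kronecker_mul, Matrix.trace_kronecker,
    Matrix.conjTranspose_one, one_mul, Matrix.trace_one, trace_mul_conjTranspose_self] at h
  exact_mod_cast h.symm

theorem kronecker_one_commute (M : Matrix I A ℂ) (N : Op E) :
    (M ⊗ₖ (1 : Op E))ᴴ * ((1 : Op I) ⊗ₖ N) = ((1 : Op A) ⊗ₖ N) * (M ⊗ₖ (1 : Op E))ᴴ := by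
  rw [Matrix.conjTranspose_kronecker, Matrix.conjTranspose_one, ← Matrix.mul_kronecker_mul,
    ← Matrix.mul_kronecker_mul]
  simp

/-- The decoder obtained by comparing purifications of Alice's post-measurement state and of
the ideal state. -/
theorem exists_decoder (M : Matrix I A ℂ) (R : Matrix (A × B) E ℂ) {s N : Op E} (hNs : N * s = 1) :
    ∃ T : Matrix B (I × (A × B)) ℂ, IsContr T ∧
      hsSq ((M ⊗ₖ (1 : Op E)) * reshape R) + Fintype.card I * hsSq R -
        √(Fintype.card I * hsSq s) *
          √(hsSq ((M ⊗ₖ (1 : Op E)) * (reshape R * (reshape R)ᴴ * ((1 : Op A) ⊗ₖ N)) *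
            (M ⊗ₖ (1 : Op E))ᴴ
            - (1 : Op I) ⊗ₖ ptr (reshape R * (reshape R)ᴴ * ((1 : Op A) ⊗ₖ N)))) ≤
      2 * ((((1 : Op I) ⊗ₖ Rᵀ)ᴴ * ((M ⊗ₖ (1 : Op E)) * reshape R)) * T).trace.re := by
  set ψ := reshape R * (reshape R)ᴴ with hψ
  set M' := M ⊗ₖ (1 : Op E) with hM'
  set G := M' * reshape R with hG
  set S := (1 : Op I) ⊗ₖ Rᵀ with hS
  obtain ⟨U, hU, hGU, -⟩ := exists_contr_factor G
  obtain ⟨V, hV, hSV, -⟩ := exists_contr_factor S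
  obtain ⟨W, hW, hPS⟩ := exists_contr_trace_sqrt_mul_sqrt_ge
    (Matrix.posSemidef_self_mul_conjTranspose G) (Matrix.posSemidef_self_mul_conjTranspose S)
  -- Composing the two polar factors makes the overlap equal to Tr √(GGᴴ)√(SSᴴ), which
  -- Powers-Størmer bounds from below.
  refine ⟨Uᴴ * V, hU.conjTranspose.mul hV, ?_⟩
  have hSV' : V * Sᴴ = CFC.sqrt (S * Sᴴ) := by
    have := congrArg Matrix.conjTranspose hSV
    rwa [Matrix.conjTranspose_mul, Matrix.conjTranspose_conjTranspose, conjTranspose_sqrt] at this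
  have e1 : (Sᴴ * G * (Uᴴ * V)).trace = (CFC.sqrt (G * Gᴴ) * CFC.sqrt (S * Sᴴ)).trace := by
    rw [← hGU, ← hSV', Matrix.trace_mul_comm (G * Uᴴ), ← Matrix.mul_assoc,
      Matrix.trace_mul_comm _ V]
    simp only [Matrix.mul_assoc]
  rw [e1]
  refine le_trans ?_ hPS
  have hG1 : (G * Gᴴ).trace.re = hsSq G := by rw [trace_mul_conjTranspose_self, Complex.ofReal_re]
  have hS1 : (S * Sᴴ).trace.re = Fintype.card I * hsSq R := by
    rw [trace_mul_conjTranspose_self, Complex.ofReal_re, hS, hsSq_one_kronecker, hsSq_transpose]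
  rw [hG1, hS1]
  have hX : G * Gᴴ - S * Sᴴ = M' * ψ * M'ᴴ - (1 : Op I) ⊗ₖ ptr ψ := by
    congr 1
    · rw [hG, hψ, Matrix.conjTranspose_mul]; simp only [Matrix.mul_assoc]
    · rw [hS, Matrix.conjTranspose_kronecker, ← Matrix.mul_kronecker_mul,
        Matrix.conjTranspose_one, one_mul, hψ, ptr_reshape]
  have hXN : (G * Gᴴ - S * Sᴴ) * ((1 : Op I) ⊗ₖ N) =
      M' * (ψ * ((1 : Op A) ⊗ₖ N)) * M'ᴴ - (1 : Op I) ⊗ₖ ptr (ψ * ((1 : Op A) ⊗ₖ N)) := by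
    rw [hX, Matrix.sub_mul, Matrix.mul_assoc, hM', kronecker_one_commute,
      ptr_mul_one_kronecker, ← Matrix.mul_kronecker_mul, one_mul]
    simp only [Matrix.mul_assoc]
  rw [← hXN]
  set X := G * Gᴴ - S * Sᴴ
  -- Insert N s = 1 and apply Cauchy-Schwarz: s goes with W, its inverse with X.
  have h1 : (W * X).trace.re ≤
      √(Fintype.card I * hsSq s) * √(hsSq (X * ((1 : Op I) ⊗ₖ N))) := by
    have e2 : (W * X).trace = (((((1 : Op I) ⊗ₖ s) * W)ᴴ)ᴴ * (X * ((1 : Op I) ⊗ₖ N))).trace := by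
      rw [Matrix.conjTranspose_conjTranspose, Matrix.mul_assoc, Matrix.trace_mul_comm
        ((1 : Op I) ⊗ₖ s), Matrix.mul_assoc, Matrix.mul_assoc, ← Matrix.mul_kronecker_mul, hNs,
        one_mul, Matrix.one_kronecker_one, Matrix.mul_one]
    rw [e2]
    refine (Complex.re_le_norm _).trans ((norm_trace_conjTranspose_mul_le _ _).trans ?_)
    gcongr
    rw [hsSq_conjTranspose, ← hsSq_one_kronecker]
    exact hW.mul_hsSq_le _
  linarith

theorem sum_hsSq_phaseMatrix_mul (G : Matrix (A × E) B ℂ) :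
    ∑ x : I × A → ZMod 3, hsSq ((phaseMatrix x ⊗ₖ (1 : Op E)) * G) =
      Fintype.card (I × A → ZMod 3) * Fintype.card I * hsSq G := by
  have h1 : ∀ x : I × A → ZMod 3, ((hsSq ((phaseMatrix x ⊗ₖ (1 : Op E)) * G) : ℝ) : ℂ) =
      (Gᴴ * ((((phaseMatrix x)ᴴ * phaseMatrix x) ⊗ₖ (1 : Op E)) * G)).trace := by
    intro x
    rw [← trace_conjTranspose_mul_self, Matrix.conjTranspose_mul, Matrix.conjTranspose_kronecker,
      Matrix.conjTranspose_one, Matrix.mul_assoc, ← Matrix.mul_assoc (_ ⊗ₖ _),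
      ← Matrix.mul_kronecker_mul, one_mul]
  have h2 : ((∑ x : I × A → ZMod 3, hsSq ((phaseMatrix x ⊗ₖ (1 : Op E)) * G) : ℝ) : ℂ) =
      ((Fintype.card (I × A → ZMod 3) * Fintype.card I * hsSq G : ℝ) : ℂ) := by
    rw [Complex.ofReal_sum]
    simp only [h1]
    rw [← Matrix.trace_sum, ← Matrix.mul_sum, ← Matrix.sum_mul]
    have h3 : ∑ x : I × A → ZMod 3, ((phaseMatrix x)ᴴ * phaseMatrix x) ⊗ₖ (1 : Op E) =
        (∑ x : I × A → ZMod 3, (phaseMatrix x)ᴴ * phaseMatrix x) ⊗ₖ (1 : Op E) := by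
      ext p q
      simp only [Matrix.sum_apply, Matrix.kroneckerMap_apply, Finset.sum_mul]
    rw [h3, sum_phaseMatrix, Matrix.smul_kronecker, Matrix.one_kronecker_one, Matrix.smul_mul,
      Matrix.one_mul, Matrix.mul_smul, Matrix.trace_smul, trace_conjTranspose_mul_self]
    push_cast
    rfl
  exact_mod_cast h2

/-- Summing the single-outcome bounds, Cauchy-Schwarz over outcomes replaces the sum of the weighted
distances by the root of their second moment, which the decoupling estimate controls. -/
theorem exists_decoders {R : Matrix (A × B) E ℂ} (hR : hsSq R ≤ 1) {s N : Op E}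
    (hNs : N * s = 1) {κ : ℝ} (hs : hsSq s ≤ κ)
    (hY : hsSq (reshape R * (reshape R)ᴴ * ((1 : Op A) ⊗ₖ N)) ≤ hsSq R) :
    ∃ T : (I × A → ZMod 3) → Matrix B (I × (A × B)) ℂ, (∀ x, IsContr (T x)) ∧
      Fintype.card (I × A → ZMod 3) * Fintype.card I *
          (hsSq R - √(Fintype.card I * κ) / 2) ≤
        ∑ x, ((((1 : Op I) ⊗ₖ Rᵀ)ᴴ * ((phaseMatrix x ⊗ₖ (1 : Op E)) * reshape R)) *
          T x).trace.re := by
  choose T hT h using fun x : I × A → ZMod 3 => exists_decoder (phaseMatrix x) R hNs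
  refine ⟨T, hT, ?_⟩
  have h1 := Finset.sum_le_sum fun x (_ : x ∈ Finset.univ) => h x
  rw [Finset.sum_sub_distrib, Finset.sum_add_distrib, sum_hsSq_phaseMatrix_mul, hsSq_reshape,
    ← Finset.mul_sum, ← Finset.mul_sum, Finset.sum_const, Finset.card_univ, nsmul_eq_mul] at h1
  set Y := reshape R * (reshape R)ᴴ * ((1 : Op A) ⊗ₖ N)
  set n : ℝ := (Fintype.card (I × A → ZMod 3) : ℝ)
  set d : ℝ := (Fintype.card I : ℝ)
  have hn : 0 ≤ n := Nat.cast_nonneg _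
  have hd : 0 ≤ d := Nat.cast_nonneg _
  set D : (I × A → ZMod 3) → ℝ := fun x => hsSq ((phaseMatrix x ⊗ₖ (1 : Op E)) * Y *
        (phaseMatrix x ⊗ₖ (1 : Op E))ᴴ - (1 : Op I) ⊗ₖ ptr Y)
  have h2 : ∑ x, √(D x) ≤ n * d := by
    have h3 : (∑ x, √(D x)) ^ 2 ≤ (n * d) ^ 2 := by
      calc (∑ x, √(D x)) ^ 2 ≤ n * ∑ x, √(D x) ^ 2 := by
            exact sq_sum_le_card_mul_sum_sq (s := Finset.univ) (f := fun x => √(D x))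
        _ = n * ∑ x, D x := by simp only [Real.sq_sqrt (hsSq_nonneg _), D]
        _ ≤ n * (n * d ^ 2 * hsSq Y) := by
            gcongr
            exact sum_hsSq_phaseMatrix_sub_le Y
        _ ≤ n * (n * d ^ 2 * 1) := by
            gcongr
            exact hY.trans hR
        _ = _ := by ring
    exact abs_le_of_sq_le_sq' h3 (by positivity) |>.2
  have h4 : √(d * hsSq s) * ∑ x, √(D x) ≤ √(d * κ) * (n * d) := by gcongr
  change n * d * _ + d * _ - _ * ∑ x, √(D x) ≤ _ at h1
  rw [← Finset.mul_sum] at h1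
  linarith

end Decoder

/-! ### Kraus maps and completion of a contraction to a channel -/

section Kraus

set_option linter.unusedSectionVars false

variable {A B A' B' ι κ : Type*} [Fintype A] [DecidableEq A] [Fintype B] [DecidableEq B]
  [Fintype A'] [DecidableEq A'] [Fintype B'] [DecidableEq B'] [Fintype ι] [Fintype κ]

/-- The completely positive map with Kraus operators `K`. -/
def kraus (K : ι → Matrix A' A ℂ) : Op A →ₗ[ℂ] Op A' where
  toFun X := ∑ i, K i * X * (K i)ᴴ
  map_add' X Y := by simp [Matrix.mul_add, Matrix.add_mul, Finset.sum_add_distrib]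
  map_smul' c X := by simp [Finset.smul_sum]

theorem kraus_apply (K : ι → Matrix A' A ℂ) (X : Op A) :
    kraus K X = ∑ i, K i * X * (K i)ᴴ := rfl

theorem tensorMap_kraus (K : ι → Matrix A' A ℂ) (K' : κ → Matrix B' B ℂ) :
    tensorMap (kraus K) (kraus K') = kraus fun p : ι × κ => K p.1 ⊗ₖ K' p.2 := by
  have hprod : ∀ (Y : Op A) (Z : Op B),
      kraus (fun p : ι × κ => K p.1 ⊗ₖ K' p.2) (Y ⊗ₖ Z) = kraus K Y ⊗ₖ kraus K' Z := by
    intro Y Z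
    simp only [kraus_apply, Fintype.sum_prod_type, Matrix.conjTranspose_kronecker,
      ← Matrix.mul_kronecker_mul]
    ext p q
    simp only [Matrix.sum_apply, Matrix.kroneckerMap_apply, Finset.sum_mul_sum]
  refine LinearMap.ext fun X => ?_
  have hX : X = ∑ a, ∑ a', ∑ b, ∑ b', X (a, b) (a', b') •
      (Matrix.single a a' (1 : ℂ) ⊗ₖ Matrix.single b b' (1 : ℂ)) := by
    conv_lhs => rw [Matrix.matrix_eq_sum_single X]
    simp only [Fintype.sum_prod_type]
    refine Finset.sum_congr rfl fun a _ => ?_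
    rw [Finset.sum_comm]
    refine Finset.sum_congr rfl fun a' _ => Finset.sum_congr rfl fun b _ =>
      Finset.sum_congr rfl fun b' _ => ?_
    rw [Matrix.single_kronecker_single, Matrix.smul_single]
    simp
  conv_rhs => rw [hX]
  simp only [map_sum, map_smul, hprod]
  rfl

theorem isCP_kraus (K : ι → Matrix A' A ℂ) : IsCP (kraus K) := by
  intro k X hX
  have h : (LinearMap.id : Op (Fin k) →ₗ[ℂ] Op (Fin k)) = kraus fun _ : Unit => 1 := by
    ext1 X; simp [kraus_apply]
  rw [h, tensorMap_kraus, kraus_apply]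
  exact Matrix.posSemidef_sum _ fun _ _ => hX.mul_mul_conjTranspose_same _

theorem trace_kraus {K : ι → Matrix A' A ℂ} (hK : ∑ i, (K i)ᴴ * K i = 1) (X : Op A) :
    (kraus K X).trace = X.trace := by
  rw [kraus_apply, Matrix.trace_sum]
  have : ∀ i, (K i * X * (K i)ᴴ).trace = ((K i)ᴴ * K i * X).trace := fun i => by
    rw [Matrix.trace_mul_comm, Matrix.mul_assoc]
  simp only [this]
  rw [← Matrix.trace_sum, ← Matrix.sum_mul, hK, one_mul]

theorem isChannel_kraus {K : ι → Matrix A' A ℂ} (hK : ∑ i, (K i)ᴴ * K i = 1) :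
    IsChannel (kraus K) := ⟨isCP_kraus K, trace_kraus hK⟩

theorem isOneWayLOCC_of_fintype {Ω : Type*} [Fintype Ω] (E : Ω → Op A →ₗ[ℂ] Op A')
    (F : Ω → Op B →ₗ[ℂ] Op B') (hE : ∀ x, IsCP (E x)) (hE' : IsChannel (∑ x, E x))
    (hF : ∀ x, IsChannel (F x)) : IsOneWayLOCC (∑ x, tensorMap (E x) (F x)) := by
  let e := (Fintype.equivFin Ω).symm
  exact ⟨Fintype.card Ω, fun k => E (e k), fun k => F (e k), fun k => hE _,
    by rwa [Equiv.sum_comp e E], fun k => hF _,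
    (Equiv.sum_comp e fun x => tensorMap (E x) (F x)).symm⟩

/-- A contraction `T` from `B` to `A' ⊗ K` becomes a channel after discarding `K`, when the missing
weight is sent to the state `|i₀⟩⟨i₀|`. -/
theorem exists_kraus_of_contr {I K : Type*} [Fintype I] [DecidableEq I] [Fintype K] [DecidableEq K]
    (i₀ : I) {T : Matrix (I × K) B ℂ} (hT : IsContr T) :
    ∃ F : K ⊕ B → Matrix I B ℂ, ∑ j, (F j)ᴴ * F j = 1 ∧ ∀ k, F (Sum.inl k) =
      T.submatrix (fun i => (i, k)) id := by
  set s := CFC.sqrt (1 - Tᴴ * T) with hs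
  have hss : s * s = 1 - Tᴴ * T := sqrt_mul_sqrt hT
  have hsh : sᴴ = s := conjTranspose_sqrt _
  let L : B → Matrix I B ℂ := fun b => Matrix.vecMulVec (Pi.single i₀ 1) (s b)
  refine ⟨Sum.elim (fun k => T.submatrix (fun i => (i, k)) id) L, ?_, fun k => rfl⟩
  rw [Fintype.sum_sum_type]
  simp only [Sum.elim_inl, Sum.elim_inr]
  have h1 : ∑ k, (T.submatrix (fun i => (i, k)) id)ᴴ * T.submatrix (fun i => (i, k)) id =
      Tᴴ * T := by
    ext b b'
    rw [Matrix.sum_apply]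
    simp only [Matrix.mul_apply, Matrix.conjTranspose_apply, Matrix.submatrix_apply, id,
      Fintype.sum_prod_type]
    exact Finset.sum_comm
  have h2 : ∑ b, (L b)ᴴ * L b = sᴴ * s := by
    ext b b'
    rw [Matrix.sum_apply, Matrix.mul_apply]
    refine Finset.sum_congr rfl fun c _ => ?_
    simp [L, Matrix.mul_apply, Matrix.vecMulVec_apply, Pi.single_apply]
  rw [h1, h2, hsh, hss]
  abel

theorem isContr_of_trace_le {J n : Type*} [Fintype J] [Fintype n] [DecidableEq n]
    {V : Matrix J n ℂ}
    (h : ∀ X : Op n, X.PosSemidef → (V * X * Vᴴ).trace.re ≤ X.trace.re) : IsContr V := by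
  have hH : (1 - Vᴴ * V).IsHermitian := by
    simp [Matrix.IsHermitian]
  refine Matrix.PosSemidef.of_dotProduct_mulVec_nonneg hH fun v => ?_
  have h1 := h _ (Matrix.posSemidef_vecMulVec_self_star v)
  have h2 : star v ⬝ᵥ ((1 - Vᴴ * V) *ᵥ v) = (Matrix.vecMulVec v (star v)).trace -
      (V * Matrix.vecMulVec v (star v) * Vᴴ).trace := by
    rw [Matrix.trace_mul_comm, ← Matrix.mul_assoc, Matrix.mul_vecMulVec, Matrix.trace_vecMulVec,
      Matrix.trace_vecMulVec, Matrix.sub_mulVec, dotProduct_sub, Matrix.one_mulVec,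
      dotProduct_comm v, dotProduct_comm _ (star v)]
  have h4 := hH.im_star_dotProduct_mulVec_self v
  rw [Complex.le_def]
  refine ⟨?_, by simpa using h4.symm⟩
  rw [h2]
  simp only [Complex.zero_re, Complex.sub_re]
  linarith

theorem re_dotProduct_mulVec_le_trace {n : Type*} [Fintype n] [DecidableEq n] {φ : n → ℂ}
    (hφ : star φ ⬝ᵥ φ = 1) {Z : Op n} (hZ : Z.PosSemidef) :
    (star φ ⬝ᵥ (Z *ᵥ φ)).re ≤ Z.trace.re := by
  set Q := Matrix.vecMulVec φ (star φ) with hQ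
  have hQh : Qᴴ = Q := by rw [hQ, Matrix.conjTranspose_vecMulVec]; simp
  have hQ2 : Q * Q = Q := by
    rw [hQ, Matrix.vecMulVec_mul_vecMulVec, hφ]; simp
  have hc : IsContr Q := by
    have h := Matrix.posSemidef_conjTranspose_mul_self (1 - Q)
    unfold IsContr
    convert h using 1
    rw [Matrix.conjTranspose_sub, Matrix.conjTranspose_one, hQh, sub_mul, mul_sub, mul_sub, hQ2]
    simp
  have h := (Complex.re_le_norm _).trans (norm_trace_contr_mul_le hc hZ)
  rwa [hQ, Matrix.vecMulVec_mul, Matrix.trace_vecMulVec, dotProduct_comm,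
    ← Matrix.dotProduct_mulVec] at h

end Kraus

/-! ### Triangle inequality for sines of angles -/

section Triangle

/-- With a and b the cosines of α and β, the expression is cos(α + β), and sin(α + β) ≤ sin α + sin
β. The condition ξ + η ≤ 1 keeps α + β below a right angle, so that the cosine is nonnegative. -/
theorem one_sub_add_sq_le {a b ξ η : ℝ} (ha0 : 0 ≤ a) (hb0 : 0 ≤ b) (ha1 : a ≤ 1) (hb1 : b ≤ 1)
    (ha : 1 - ξ ^ 2 ≤ a ^ 2) (hb : 1 - η ^ 2 ≤ b ^ 2) (hξ : 0 ≤ ξ) (hη : 0 ≤ η)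
    (hξη : ξ + η ≤ 1) :
    0 ≤ a * b - √(1 - a ^ 2) * √(1 - b ^ 2) ∧
      1 - (ξ + η) ^ 2 ≤ (a * b - √(1 - a ^ 2) * √(1 - b ^ 2)) ^ 2 := by
  set p := √(1 - a ^ 2)
  set q := √(1 - b ^ 2)
  have hp0 : 0 ≤ p := Real.sqrt_nonneg _
  have hq0 : 0 ≤ q := Real.sqrt_nonneg _
  have hp : p ^ 2 = 1 - a ^ 2 := Real.sq_sqrt (by nlinarith)
  have hq : q ^ 2 = 1 - b ^ 2 := Real.sq_sqrt (by nlinarith)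
  have hpξ : p ≤ ξ := abs_le_of_sq_le_sq' (by linarith) hξ |>.2
  have hqη : q ≤ η := abs_le_of_sq_le_sq' (by linarith) hη |>.2
  have hpq : p ^ 2 + q ^ 2 ≤ 1 := by nlinarith [mul_nonneg hp0 hq0]
  have h1 : (p * q) ^ 2 ≤ (a * b) ^ 2 := by
    have : (a * b) ^ 2 = (1 - p ^ 2) * (1 - q ^ 2) := by rw [hp, hq]; ring
    rw [this]; nlinarith
  have h2 : p * q ≤ a * b := abs_le_of_sq_le_sq' h1 (by positivity) |>.2
  refine ⟨by linarith, ?_⟩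
  have h3 : (a * b - p * q) ^ 2 = 1 - (p + q) ^ 2 + 2 * (p * q) * (1 - a * b + p * q) := by
    have ha' : a ^ 2 = 1 - p ^ 2 := by linarith
    have hb' : b ^ 2 = 1 - q ^ 2 := by linarith
    have : (a * b - p * q) ^ 2 = a ^ 2 * b ^ 2 - 2 * (a * b) * (p * q) + p ^ 2 * q ^ 2 := by ring
    rw [this, ha', hb']; ring
  have h4 : a * b ≤ 1 := mul_le_one₀ ha1 hb0 hb1
  have h5 : (p + q) ^ 2 ≤ (ξ + η) ^ 2 := by gcongr
  have h6 : 0 ≤ 2 * (p * q) * (1 - a * b + p * q) := by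
    have : 0 ≤ p * q := mul_nonneg hp0 hq0
    apply mul_nonneg <;> linarith
  rw [h3]; linarith

variable {H : Type*} [NormedAddCommGroup H] [InnerProductSpace ℂ H]

theorem norm_sub_inner_smul_sq {u v : H} (hu : ‖u‖ = 1) :
    ‖v - inner ℂ u v • u‖ ^ 2 = ‖v‖ ^ 2 - ‖inner ℂ u v‖ ^ 2 := by
  have h1 : inner ℂ u (v - inner ℂ u v • u) = 0 := by
    rw [inner_sub_right, inner_smul_right, inner_self_eq_norm_sq_to_K, hu]; simp
  have h2 : v = (v - inner ℂ u v • u) + inner ℂ u v • u := by abel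
  have h3 : inner ℂ (v - inner ℂ u v • u) (inner ℂ u v • u) = 0 := by
    rw [inner_smul_right, inner_eq_zero_symm.1 h1, mul_zero]
  have h4 := norm_add_sq_eq_norm_sq_add_norm_sq_of_inner_eq_zero _ _ h3
  rw [← h2, norm_smul, hu, mul_one] at h4
  nlinarith

/-- The triangle inequality for the sine of the angle between vectors. -/
theorem one_sub_add_sq_le_norm_inner_sq {y u v : H} {ξ η : ℝ} (hu : ‖u‖ = 1) (hy : ‖y‖ ≤ 1)
    (hv : ‖v‖ ≤ 1) (huv : 1 - ξ ^ 2 ≤ ‖inner ℂ u v‖ ^ 2) (hyu : 1 - η ^ 2 ≤ ‖inner ℂ u y‖ ^ 2)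
    (hξ : 0 ≤ ξ) (hη : 0 ≤ η) (hξη : ξ + η ≤ 1) :
    1 - (ξ + η) ^ 2 ≤ ‖inner ℂ y v‖ ^ 2 := by
  have ha1 : ‖inner ℂ u v‖ ≤ 1 :=
    (norm_inner_le_norm u v).trans (by rw [hu, one_mul]; exact hv)
  have hb1 : ‖inner ℂ u y‖ ≤ 1 :=
    (norm_inner_le_norm u y).trans (by rw [hu, one_mul]; exact hy)
  obtain ⟨h0, h1⟩ := one_sub_add_sq_le (norm_nonneg _) (norm_nonneg _) ha1 hb1 huv hyu hξ hη hξη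
  refine h1.trans ?_
  gcongr
  have e : inner ℂ y v = inner ℂ u v * inner ℂ y u +
      inner ℂ (y - inner ℂ u y • u) (v - inner ℂ u v • u) := by
    have h3 : inner ℂ u (v - inner ℂ u v • u) = 0 := by
      rw [inner_sub_right, inner_smul_right, inner_self_eq_norm_sq_to_K, hu]; simp
    rw [inner_sub_left, inner_smul_left, h3, inner_sub_right, inner_smul_right]
    ring
  have h2 : ‖inner ℂ (y - inner ℂ u y • u) (v - inner ℂ u v • u)‖ ≤
      √(1 - ‖inner ℂ u v‖ ^ 2) * √(1 - ‖inner ℂ u y‖ ^ 2) := by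
    refine (norm_inner_le_norm _ _).trans ?_
    rw [mul_comm]
    have hv2 : ‖v‖ ^ 2 ≤ 1 := pow_le_one₀ (norm_nonneg _) hv
    have hy2 : ‖y‖ ^ 2 ≤ 1 := pow_le_one₀ (norm_nonneg _) hy
    gcongr
    · exact Real.le_sqrt_of_sq_le (by rw [norm_sub_inner_smul_sq hu]; linarith)
    · exact Real.le_sqrt_of_sq_le (by rw [norm_sub_inner_smul_sq hu]; linarith)
  have h3 := norm_sub_le (inner ℂ y v) (inner ℂ (y - inner ℂ u y • u) (v - inner ℂ u v • u))
  have h4 : ‖inner ℂ u v‖ * ‖inner ℂ u y‖ =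
      ‖inner ℂ y v - inner ℂ (y - inner ℂ u y • u) (v - inner ℂ u v • u)‖ := by
    rw [e, add_sub_cancel_right, norm_mul, norm_inner_symm y u]
  linarith

end Triangle

/-! ### Transfer from the smoothed state to the true state -/

section Overlap

set_option linter.unusedSectionVars false

variable {n m J : Type*} [Fintype n] [DecidableEq n] [Fintype J] [DecidableEq J] [Fintype m]
  [DecidableEq m]

/-- The operator `Y` and the scalar `t`, as a vector. -/
def opVec (Y : Matrix n m ℂ) (t : ℂ) : EuclideanSpace ℂ ((n × m) ⊕ Unit) :=
  WithLp.toLp 2 (Sum.elim (fun p => Y p.1 p.2) fun _ => t)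

theorem inner_opVec (Y Z : Matrix n m ℂ) (t u : ℂ) :
    inner ℂ (opVec Y t) (opVec Z u) = (Yᴴ * Z).trace + star t * u := by
  rw [trace_conjTranspose_mul]
  simp [opVec, PiLp.inner_apply, Fintype.sum_prod_type, mul_comm]

theorem norm_opVec_sq (Y : Matrix n m ℂ) (t : ℂ) : ‖opVec Y t‖ ^ 2 = hsSq Y + ‖t‖ ^ 2 := by
  rw [EuclideanSpace.norm_sq_eq]
  simp [opVec, hsSq, Fintype.sum_prod_type]

/-- Compare three vectors: a purification of ρ', a vector from ρ realizing the fidelity with it, and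
the ideal output g pulled back through V. The extra coordinate t normalizes the first.
Cauchy-Schwarz then bounds the overlap of the last two by the norm of V√ρ. -/
theorem overlap_bound {ρ ρ' : Op n} (hρ : IsState ρ) (hρ' : IsSubState ρ') {ξ η r : ℝ}
    (hfid : 1 - ξ ^ 2 ≤ fidelity ρ ρ') (hξ : 0 ≤ ξ) (hη : 0 ≤ η) (hξη : ξ + η ≤ 1)
    {V : Matrix J n ℂ} (hV : IsContr V) {g : Matrix J n ℂ} (hg : hsSq g = hsSq (CFC.sqrt ρ'))
    (hr : r ≤ 1) (hr' : 1 - η ^ 2 ≤ (1 - r) ^ 2)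
    (hgV : hsSq (CFC.sqrt ρ') - r ≤ (gᴴ * V * CFC.sqrt ρ').trace.re) :
    1 - (ξ + η) ^ 2 ≤ (V * ρ * Vᴴ).trace.re := by
  set R := CFC.sqrt ρ' with hRd
  have hR : hsSq R = ρ'.trace.re := by
    have h := trace_mul_conjTranspose_self R
    rw [hRd, conjTranspose_sqrt, sqrt_mul_sqrt hρ'.1] at h
    rw [h]; simp [hRd]
  have hR1 : hsSq R ≤ 1 := hR ▸ hρ'.2
  set t := √(1 - hsSq R)
  have ht : t ^ 2 = 1 - hsSq R := Real.sq_sqrt (by linarith)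
  have htn : ‖(t : ℂ)‖ ^ 2 = t ^ 2 := by rw [Complex.norm_real, Real.norm_eq_abs, sq_abs]
  have hsp : (CFC.sqrt ρ)ᴴ = CFC.sqrt ρ := conjTranspose_sqrt ρ
  have hsp2 : CFC.sqrt ρ * CFC.sqrt ρ = ρ := sqrt_mul_sqrt hρ.1
  -- W attains the trace norm, so √ρ Wᴴ has overlap √F(ρ, ρ') with R; being a contraction, it keeps
  -- the norm at most 1.
  obtain ⟨W, hW, hWt⟩ := exists_contr_trace_eq_traceNorm (CFC.sqrt ρ * R)
  set R₀ := CFC.sqrt ρ * Wᴴ with hR₀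
  have hR₀h : R₀ᴴ = W * CFC.sqrt ρ := by
    rw [hR₀, Matrix.conjTranspose_mul, Matrix.conjTranspose_conjTranspose, hsp]
  have hρ1 : hsSq (CFC.sqrt ρ) = 1 := by
    have h := trace_mul_conjTranspose_self (CFC.sqrt ρ)
    rw [hsp, hsp2, hρ.2] at h
    exact_mod_cast h.symm
  have hR₀1 : hsSq R₀ ≤ 1 := hρ1 ▸ hW.conjTranspose.mul_hsSq_le _
  have key := one_sub_add_sq_le_norm_inner_sq (y := opVec (Vᴴ * g) t) (u := opVec R t)
    (v := opVec R₀ 0) (ξ := ξ) (η := η) ?_ ?_ ?_ ?_ ?_ hξ hη hξη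
  · refine key.trans ?_
    rw [inner_opVec, mul_zero, add_zero, Matrix.conjTranspose_mul,
      Matrix.conjTranspose_conjTranspose, Matrix.mul_assoc]
    refine (norm_trace_conjTranspose_mul_sq_le _ _).trans ?_
    have h1 : hsSq (V * R₀) ≤ (V * ρ * Vᴴ).trace.re := by
      have h2 : hsSq (V * CFC.sqrt ρ) = (V * ρ * Vᴴ).trace.re := by
        have h3 := trace_mul_conjTranspose_self (V * CFC.sqrt ρ)
        rw [Matrix.conjTranspose_mul, hsp, Matrix.mul_assoc, ← Matrix.mul_assoc (CFC.sqrt ρ),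
          hsp2, ← Matrix.mul_assoc] at h3
        rw [h3, Complex.ofReal_re]
      rw [← h2, hR₀, ← Matrix.mul_assoc]
      exact hW.conjTranspose.mul_hsSq_le _
    calc hsSq g * hsSq (V * R₀) ≤ 1 * hsSq (V * R₀) := by
          gcongr
          · exact hsSq_nonneg _
          · rw [hg]; exact hR1
      _ ≤ _ := by rw [one_mul]; exact h1
  · have h := norm_opVec_sq R t
    rw [htn, ht, add_sub_cancel] at h
    exact (pow_eq_one_iff_of_nonneg (norm_nonneg _) two_ne_zero).1 h
  · have h := norm_opVec_sq (Vᴴ * g) t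
    have h2 := hV.conjTranspose.hsSq_mul_le g
    rw [htn, ht] at h
    exact (sq_le_one_iff₀ (norm_nonneg _)).1 (by rw [h]; linarith)
  · have h := norm_opVec_sq R₀ 0
    exact (sq_le_one_iff₀ (norm_nonneg _)).1 (by rw [h]; simpa using hR₀1)
  · rw [norm_inner_symm, inner_opVec, star_zero, zero_mul, add_zero, hR₀h, Matrix.mul_assoc, hWt,
      Complex.norm_real, Real.norm_eq_abs, sq_abs]
    exact hfid
  · rw [norm_inner_symm, inner_opVec, Matrix.conjTranspose_mul, Matrix.conjTranspose_conjTranspose]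
    refine hr'.trans ?_
    have h1 : 1 - r ≤ ((gᴴ * V * R).trace + star (t : ℂ) * t).re := by
      have h2 : (star (t : ℂ) * t) = ((t ^ 2 : ℝ) : ℂ) := by
        rw [RCLike.star_def, Complex.conj_ofReal]; push_cast; ring
      rw [h2, Complex.add_re, Complex.ofReal_re, ht]
      linarith
    have h2 := h1.trans (Complex.re_le_norm _)
    gcongr

end Overlap

/-! ### From the entropy condition to a fidelity bound -/

section Entropy

theorem log2_ofReal {x : ℝ} (hx : 0 < x) :
    log2 (ENNReal.ofReal x) = ((Real.log x / Real.log 2 : ℝ) : EReal) := by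
  rw [log2, ENNReal.log_ofReal_of_pos hx, ← EReal.coe_div]

theorem log2_mono {x y : ℝ≥0∞} (h : x ≤ y) : log2 x ≤ log2 y :=
  EReal.div_le_div_right_of_nonneg (by exact_mod_cast (Real.log_pos one_lt_two).le)
    (ENNReal.log_le_log h)

variable {A B : Type*} [Fintype A] [DecidableEq A] [Fintype B] [DecidableEq B]

/-- The infimum in the entropy need not be attained; the factor 1 + θ gives the strict room that
makes the contrary assumption contradict the condition on d. -/
theorem exists_mem_purifiedBall_fidelity_le {ρ : Op (A × B)} {ξ η θ : ℝ} (hη : 0 < η) (hθ : 0 < θ)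
    {d : ℕ} (hd : 1 ≤ d)
    (hlog : log2 (d : ℝ≥0∞) ≤
      -smoothMaxEntropy ξ ρ - 4 * log2 (1 / ENNReal.ofReal η)) :
    ∃ ρ' ∈ purifiedBall ξ ρ, ∀ σ : Op B, IsState σ →
      fidelity ρ' ((1 : Op A) ⊗ₖ σ) ≤ η ^ 4 * (1 + θ) / d := by
  by_contra! h
  have hd0 : (0 : ℝ) < d := by exact_mod_cast hd
  set c : ℝ := η ^ 4 * (1 + θ) / d with hc
  have hc0 : 0 < c := by positivity
  have h1 : ((Real.log c / Real.log 2 : ℝ) : EReal) ≤ smoothMaxEntropy ξ ρ := by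
    rw [← log2_ofReal hc0]
    refine le_iInf₂ fun ρ' hρ' => ?_
    obtain ⟨σ, hσ, hlt⟩ := h ρ' hρ'
    exact (log2_mono (ENNReal.ofReal_le_ofReal hlt.le)).trans
      (le_iSup₂ (f := fun (σ : Op B) (_ : σ ∈ {σ : Op B | IsState σ}) =>
        log2 (ENNReal.ofReal (fidelity ρ' ((1 : Op A) ⊗ₖ σ)))) σ hσ)
  have h2 : (1 : ℝ≥0∞) / ENNReal.ofReal η = ENNReal.ofReal (1 / η) := by
    rw [ENNReal.ofReal_div_of_pos hη, ENNReal.ofReal_one]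
  have h3 : (d : ℝ≥0∞) = ENNReal.ofReal d := by simp
  rw [h2, h3, log2_ofReal hd0, log2_ofReal (by positivity)] at hlog
  have h4 := hlog.trans (EReal.sub_le_sub (EReal.neg_le_neg_iff.2 h1) le_rfl)
  have h5 : Real.log d / Real.log 2 ≤
      -(Real.log c / Real.log 2) - 4 * (Real.log (1 / η) / Real.log 2) := by
    rw [show (4 : EReal) = ((4 : ℝ) : EReal) from rfl] at h4
    exact_mod_cast h4
  have h6 : Real.log c = 4 * Real.log η + Real.log (1 + θ) - Real.log d := by
    rw [hc, Real.log_div (by positivity) hd0.ne', Real.log_mul (by positivity) (by positivity),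
      Real.log_pow]
    norm_num
  have h7 : Real.log (1 / η) = -Real.log η := by rw [one_div, Real.log_inv]
  have h8 : 0 < Real.log (1 + θ) := Real.log_pos (by linarith)
  have h9 : 0 < Real.log 2 := Real.log_pos one_lt_two
  rw [h6, h7] at h5
  have h10 : Real.log (1 + θ) / Real.log 2 ≤ 0 := by
    have : Real.log (1 + θ) / Real.log 2 = Real.log d / Real.log 2 -
      (-((4 * Real.log η + Real.log (1 + θ) - Real.log d) / Real.log 2) -
        4 * (-Real.log η / Real.log 2)) := by ring
    rw [this]; linarith
  exact absurd h10 (not_le.2 (div_pos h8 h9))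

end Entropy

/-! ### Purified distance to a normalized state -/

section Extend

variable {n m : Type*} [Fintype n] [DecidableEq n] [Fintype m] [DecidableEq m]

theorem posSemidef_fromBlocks_diag {P : Op n} {Q : Op m} (hP : P.PosSemidef) (hQ : Q.PosSemidef) :
    (Matrix.fromBlocks P 0 0 Q).PosSemidef := by
  have h := Matrix.posSemidef_conjTranspose_mul_self
    (Matrix.fromBlocks (CFC.sqrt P) 0 0 (CFC.sqrt Q))
  rw [Matrix.fromBlocks_conjTranspose, Matrix.fromBlocks_multiply] at h
  simpa [conjTranspose_sqrt, sqrt_mul_sqrt hP, sqrt_mul_sqrt hQ] using h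

theorem sqrt_fromBlocks_diag {P : Op n} {Q : Op m} (hP : P.PosSemidef) (hQ : Q.PosSemidef) :
    CFC.sqrt (Matrix.fromBlocks P 0 0 Q) = Matrix.fromBlocks (CFC.sqrt P) 0 0 (CFC.sqrt Q) := by
  refine CFC.sqrt_unique ?_ (posSemidef_fromBlocks_diag (posSemidef_sqrt P)
    (posSemidef_sqrt Q)).nonneg
  rw [Matrix.fromBlocks_multiply]
  simp [sqrt_mul_sqrt hP, sqrt_mul_sqrt hQ]

/-- The added block of ρ is zero, so the added block of ρ' contributes nothing to the product of
roots. -/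
theorem fidelity_extend {ρ ρ' : Op n} (hρ : IsState ρ) (hρ' : IsSubState ρ') :
    fidelity (extend ρ) (extend ρ') = fidelity ρ ρ' := by
  have h1 : extend ρ = Matrix.fromBlocks ρ 0 0 (0 : Op Unit) := by
    unfold extend; congr; ext; simp [hρ.2]
  have h0 : extend ρ' = Matrix.fromBlocks ρ' 0 0 (Matrix.diagonal fun _ : Unit => 1 - ρ'.trace) := by
    unfold extend; congr
  have h2 : (Matrix.diagonal fun _ : Unit => 1 - ρ'.trace).PosSemidef := by
    rw [Matrix.posSemidef_diagonal_iff]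
    intro _
    rw [← ofReal_re_trace hρ'.1, ← Complex.ofReal_one, ← Complex.ofReal_sub]
    exact_mod_cast sub_nonneg.2 hρ'.2
  unfold fidelity traceNorm
  rw [h1, h0, sqrt_fromBlocks_diag hρ.1 Matrix.PosSemidef.zero, sqrt_fromBlocks_diag hρ'.1 h2,
    Matrix.fromBlocks_multiply, Matrix.fromBlocks_conjTranspose, Matrix.fromBlocks_multiply]
  simp only [CFC.sqrt_zero, Matrix.zero_mul, Matrix.mul_zero, add_zero, Matrix.conjTranspose_zero]
  rw [sqrt_fromBlocks_diag (Matrix.posSemidef_conjTranspose_mul_self _) Matrix.PosSemidef.zero,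
    CFC.sqrt_zero]
  simp only [Matrix.trace, Fintype.sum_sum_type, Matrix.diag_apply, Matrix.fromBlocks_apply₁₁,
    Matrix.fromBlocks_apply₂₂, Matrix.zero_apply, Finset.sum_const_zero, add_zero]

theorem fidelity_ge_of_mem_purifiedBall {ρ ρ' : Op n} (hρ : IsState ρ) {ξ : ℝ} (hξ : 0 ≤ ξ)
    (h : ρ' ∈ purifiedBall ξ ρ) : 1 - ξ ^ 2 ≤ fidelity ρ ρ' := by
  have h1 := h.2
  rw [purifiedDist, sineDist, fidelity_extend hρ h.1, Real.sqrt_le_left hξ] at h1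
  linarith

end Extend

/-! ### The protocol and its analysis -/

section Protocol

variable {A B K : Type*} [Fintype A] [DecidableEq A] [Fintype B] [DecidableEq B]
  [Fintype K] [DecidableEq K]

theorem star_maxEntVec (d : ℕ) : star (maxEntVec d) = maxEntVec d := by
  ext p
  simp only [maxEntVec, Pi.star_apply]
  split_ifs
  · rw [RCLike.star_def, Complex.conj_ofReal]
  · simp

theorem sum_maxEntVec_mul (d : ℕ) (f : Fin d × Fin d → ℂ) :
    ∑ p, maxEntVec d p * f p = ∑ i, ((1 / √(d : ℝ) : ℝ) : ℂ) * f (i, i) := by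
  rw [Fintype.sum_prod_type]
  refine Finset.sum_congr rfl fun i _ => ?_
  rw [Finset.sum_eq_single i (fun j _ h => by simp [maxEntVec, Ne.symm h]) (by simp)]
  simp [maxEntVec]

theorem maxEntVec_dotProduct {d : ℕ} (hd : 1 ≤ d) : star (maxEntVec d) ⬝ᵥ maxEntVec d = 1 := by
  have hd0 : (0 : ℝ) < d := by exact_mod_cast hd
  rw [star_maxEntVec, dotProduct, sum_maxEntVec_mul]
  simp only [maxEntVec, if_true, Finset.sum_const, Finset.card_univ, Fintype.card_fin,
    nsmul_eq_mul]
  rw [← Complex.ofReal_mul, ← Complex.ofReal_natCast, ← Complex.ofReal_mul]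
  have : (d : ℝ) * (1 / √(d : ℝ) * (1 / √(d : ℝ))) = 1 := by
    rw [div_mul_div_comm, Real.mul_self_sqrt hd0.le]
    field_simp
  rw [this, Complex.ofReal_one]

/-- The protocol in which Alice measures the random-phase instrument and Bob applies the decoders
`T`. -/
theorem exists_oneWayLOCC {d : ℕ} (hd : 1 ≤ d)
    {T : (Fin d × A → ZMod 3) → Matrix B (Fin d × K) ℂ} (hT : ∀ x, IsContr (T x)) :
    ∃ L : Op (A × B) →ₗ[ℂ] Op (Fin d × Fin d), IsOneWayLOCC L ∧
      (∀ X, X.PosSemidef → (L X).PosSemidef) ∧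
      ∃ V : Matrix ((Fin d × A → ZMod 3) × K) (A × B) ℂ, IsContr V ∧
        (∀ X, X.PosSemidef → (V * X * Vᴴ).trace.re ≤
          (star (maxEntVec d) ⬝ᵥ (L X *ᵥ maxEntVec d)).re) ∧
        ∀ x k a b, V (x, k) (a, b) =
          ((1 / (d * √(Fintype.card (Fin d × A → ZMod 3))) : ℝ) : ℂ) *
            ∑ i, phaseMatrix x i a * T x b (i, k) := by
  have hd0 : (0 : ℝ) < d := by exact_mod_cast hd
  set N : ℝ := (Fintype.card (Fin d × A → ZMod 3) : ℝ)
  have hN0 : 0 < N := by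
    have : 0 < Fintype.card (Fin d × A → ZMod 3) := Fintype.card_pos
    exact Nat.cast_pos.2 this
  -- The phase matrices satisfy ∑ₓ MᴴM = N d · 1, so this scaling makes the instrument exactly trace
  -- preserving.
  set c : ℝ := 1 / √(d * N) with hc
  have hc2 : c * c * (N * d) = 1 := by
    rw [hc, div_mul_div_comm, Real.mul_self_sqrt (by positivity)]
    field_simp
  set φ := maxEntVec d
  have hφ : star φ ⬝ᵥ φ = 1 := maxEntVec_dotProduct hd
  choose F hF hFinl using fun x => exists_kraus_of_contr (⟨0, hd⟩ : Fin d) (hT x).transpose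
  set M : (Fin d × A → ZMod 3) → Matrix (Fin d) A ℂ := fun x => (c : ℂ) • phaseMatrix x with hMd
  have hM : ∑ x, (M x)ᴴ * M x = 1 := by
    have : ∀ x, (M x)ᴴ * M x = ((c * c : ℝ) : ℂ) • ((phaseMatrix x)ᴴ * phaseMatrix x) := by
      intro x
      simp only [hMd, Matrix.conjTranspose_smul, Matrix.smul_mul, Matrix.mul_smul, smul_smul]
      rw [RCLike.star_def, Complex.conj_ofReal, Complex.ofReal_mul]
    simp only [this]
    rw [← Finset.smul_sum, sum_phaseMatrix, smul_smul, ← Complex.ofReal_mul, Fintype.card_fin,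
      hc2, Complex.ofReal_one, one_smul]
  set W : (Fin d × A → ZMod 3) × (K ⊕ B) → Matrix (Fin d × Fin d) (A × B) ℂ :=
    fun p => M p.1 ⊗ₖ F p.1 p.2 with hWd
  have hW : ∑ p, (W p)ᴴ * W p = 1 := by
    rw [Fintype.sum_prod_type]
    have : ∀ x, ∑ j, (W (x, j))ᴴ * W (x, j) = ((M x)ᴴ * M x) ⊗ₖ (1 : Op B) := by
      intro x
      rw [← hF x]
      simp only [hWd, Matrix.conjTranspose_kronecker, ← Matrix.mul_kronecker_mul]
      ext p q
      simp only [Matrix.sum_apply, Matrix.kroneckerMap_apply, Finset.mul_sum]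
    simp only [this]
    rw [← Matrix.one_kronecker_one, ← hM]
    ext p q
    simp only [Matrix.sum_apply, Matrix.kroneckerMap_apply, Finset.sum_mul]
  have hL : ∑ x, tensorMap (kraus fun _ : Unit => M x) (kraus (F x)) = kraus W := by
    refine LinearMap.ext fun X => ?_
    rw [LinearMap.sum_apply, kraus_apply, Fintype.sum_prod_type]
    refine Finset.sum_congr rfl fun x _ => ?_
    rw [tensorMap_kraus, kraus_apply, Fintype.sum_prod_type]
    simp [hWd]
  have hpos : ∀ X : Op (A × B), X.PosSemidef → (kraus W X).PosSemidef := fun X hX =>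
    Matrix.posSemidef_sum _ fun _ _ => hX.mul_mul_conjTranspose_same _
  refine ⟨kraus W, ?_, hpos, ?_⟩
  · rw [← hL]
    refine isOneWayLOCC_of_fintype _ _ (fun x => isCP_kraus _) ?_ fun x => isChannel_kraus (hF x)
    have : ∑ x, kraus (fun _ : Unit => M x) = kraus M := by
      refine LinearMap.ext fun X => ?_
      simp [LinearMap.sum_apply, kraus_apply]
    rw [this]
    exact isChannel_kraus hM
  -- The amplitudes of the output against ⟨Φ|, keeping only the Kraus operators that come from T;
  -- the discarded completion terms contribute nonnegatively.
  let V : Matrix ((Fin d × A → ZMod 3) × K) (A × B) ℂ := fun p => star φ ᵥ* W (p.1, Sum.inl p.2)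
  have hVX : ∀ X : Op (A × B), X.PosSemidef →
      (V * X * Vᴴ).trace.re ≤ (star φ ⬝ᵥ (kraus W X *ᵥ φ)).re := by
    intro X hX
    have h1 : ∀ p, (V * X * Vᴴ) p p =
        star φ ⬝ᵥ ((W (p.1, Sum.inl p.2) * X * (W (p.1, Sum.inl p.2))ᴴ) *ᵥ φ) := by
      intro p
      have h2 : (V * X * Vᴴ) p p = (V p ᵥ* X) ⬝ᵥ star (V p) := by
        simp only [Matrix.mul_apply, dotProduct, Matrix.vecMul, Matrix.conjTranspose_apply,
          Pi.star_apply]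
      rw [h2, Matrix.star_vecMul, star_star, Matrix.vecMul_vecMul, ← Matrix.dotProduct_mulVec,
        Matrix.mulVec_mulVec]
    have h3 : star φ ⬝ᵥ (kraus W X *ᵥ φ) =
        ∑ p, star φ ⬝ᵥ ((W p * X * (W p)ᴴ) *ᵥ φ) := by
      rw [kraus_apply, Matrix.sum_mulVec, dotProduct_sum]
    rw [h3, Matrix.trace, Complex.re_sum, Complex.re_sum, Fintype.sum_prod_type,
      Fintype.sum_prod_type]
    refine Finset.sum_le_sum fun x _ => ?_
    rw [Fintype.sum_sum_type]
    simp only [Matrix.diag_apply, h1]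
    refine le_add_of_nonneg_right (Finset.sum_nonneg fun b _ => ?_)
    exact (hX.mul_mul_conjTranspose_same _).re_dotProduct_nonneg φ
  refine ⟨V, isContr_of_trace_le fun X hX => ?_, hVX, fun x k a b => ?_⟩
  · rw [← trace_kraus hW X]
    exact (hVX X hX).trans (re_dotProduct_mulVec_le_trace hφ (hpos X hX))
  · have h1 : V (x, k) (a, b) = ∑ p, φ p * W (x, Sum.inl k) p (a, b) := by
      change (star φ ᵥ* W (x, Sum.inl k)) (a, b) = _
      rw [star_maxEntVec]; rfl
    rw [h1, sum_maxEntVec_mul, Finset.mul_sum]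
    refine Finset.sum_congr rfl fun i _ => ?_
    have h2 : W (x, Sum.inl k) (i, i) (a, b) = (c : ℂ) * (phaseMatrix x i a * T x b (i, k)) := by
      simp only [hWd, hFinl, Matrix.kroneckerMap_apply, hMd, Matrix.smul_apply, smul_eq_mul,
        Matrix.submatrix_apply, Matrix.transpose_apply, id]
      ring
    have h3 : 1 / √(d : ℝ) * c = 1 / (d * √N) := by
      rw [hc, Real.sqrt_mul hd0.le, div_mul_div_comm, ← mul_assoc, Real.mul_self_sqrt hd0.le, one_mul]
    rw [h2, ← mul_assoc, ← Complex.ofReal_mul, h3]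

/-- Regroups the decoder's overlap so that the inner sum over i is, up to a scalar, an entry of the
amplitude matrix V of the protocol. -/
theorem trace_decoder_eq {I : Type*} [Fintype I] [DecidableEq I] (M : Matrix I A ℂ)
    (R : Matrix (A × B) K ℂ) (T : Matrix B (I × (A × B)) ℂ) :
    ((((1 : Op I) ⊗ₖ Rᵀ)ᴴ * ((M ⊗ₖ (1 : Op K)) * reshape R)) * T).trace =
      ∑ k, ∑ e, star (R k e) * ∑ a, ∑ b, (∑ i, M i a * T b (i, k)) * R (a, b) e := by
  have h1 : ∀ i e b, ((M ⊗ₖ (1 : Op K)) * reshape R) (i, e) b = ∑ a, M i a * R (a, b) e := by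
    intro i e b
    rw [Matrix.mul_apply, Fintype.sum_prod_type]
    refine Finset.sum_congr rfl fun a _ => ?_
    rw [Finset.sum_eq_single e (fun e' _ h => by simp [Ne.symm h]) (by simp)]
    simp [reshape]
  have h2 : ∀ i e (f : I × (A × B) → ℂ), ∑ p, star (((1 : Op I) ⊗ₖ Rᵀ) (i, e) p) * f p =
      ∑ k, star (R k e) * f (i, k) := by
    intro i e f
    rw [Fintype.sum_prod_type, Finset.sum_eq_single i (fun j _ h => by simp [Ne.symm h]) (by simp)]
    simp
  have h3 : ∀ p q, ((M ⊗ₖ (1 : Op K)) * reshape R * T) p q =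
      ∑ b, ((M ⊗ₖ (1 : Op K)) * reshape R) p b * T b q := fun _ _ => Matrix.mul_apply
  rw [Matrix.mul_assoc, trace_conjTranspose_mul, Fintype.sum_prod_type]
  simp only [h2, h3, h1]
  rw [Finset.sum_comm]
  conv_rhs => rw [Finset.sum_comm]
  refine Finset.sum_congr rfl fun e _ => ?_
  rw [Finset.sum_comm]
  refine Finset.sum_congr rfl fun k _ => ?_
  rw [← Finset.mul_sum]
  congr 1
  simp only [Finset.sum_mul]
  rw [Finset.sum_comm]
  conv_rhs => rw [Finset.sum_comm]
  refine Finset.sum_congr rfl fun b _ => ?_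
  rw [Finset.sum_comm]
  refine Finset.sum_congr rfl fun a _ => Finset.sum_congr rfl fun i _ => ?_
  ring

/-- One-way entanglement distillation from a state that is close to one with small conditional
max-entropy. -/
theorem exists_oneWayLOCC_fidelity_ge [Nonempty A] {ρ ρ' : Op (A × B)} (hρ : IsState ρ)
    (hρ' : IsSubState ρ') {ξ η κ κ' r : ℝ} (hfid : 1 - ξ ^ 2 ≤ fidelity ρ ρ') (hξ : 0 ≤ ξ)
    (hη : 0 ≤ η) (hξη : ξ + η ≤ 1) (hκ : 0 ≤ κ) (hκ' : κ < κ')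
    (hσ : ∀ σ : Op B, IsState σ → fidelity ρ' ((1 : Op A) ⊗ₖ σ) ≤ κ) {d : ℕ} (hd : 1 ≤ d)
    (hr : r ≤ 1) (hr' : 1 - η ^ 2 ≤ (1 - r) ^ 2) (hdκ : √(d * κ') / 2 ≤ r) :
    ∃ L : Op (A × B) →ₗ[ℂ] Op (Fin d × Fin d), IsOneWayLOCC L ∧
      1 - (ξ + η) ^ 2 ≤ fidelity (maxEntState d) (L ρ) := by
  have hd0 : (0 : ℝ) < d := by exact_mod_cast hd
  set R := CFC.sqrt ρ' with hRd
  have hRR : R * Rᴴ = ρ' := by rw [hRd, conjTranspose_sqrt, sqrt_mul_sqrt hρ'.1]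
  have hR1 : hsSq R ≤ 1 := by
    have h := trace_mul_conjTranspose_self R
    rw [hRR] at h
    have h2 := hρ'.2
    rwa [h, Complex.ofReal_re] at h2
  obtain ⟨s, N, hNs, hs, hY⟩ := exists_collision_bound (R := R) hκ hκ' (by rwa [hRR])
  obtain ⟨T, hT, hTsum⟩ := exists_decoders (I := Fin d) hR1 hNs hs hY
  obtain ⟨L, hL, hLpos, V, hV, hVL, hVe⟩ := exists_oneWayLOCC hd hT
  refine ⟨L, hL, ?_⟩
  refine le_trans ?_ ((hVL ρ hρ.1).trans (dotProduct_mulVec_le_fidelity _ (hLpos ρ hρ.1)))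
  rw [Fintype.card_fin] at hTsum
  set n : ℝ := (Fintype.card (Fin d × A → ZMod 3) : ℝ) with hn
  have hn0 : 0 < n := by
    have : 0 < Fintype.card (Fin d × A → ZMod 3) := Fintype.card_pos
    exact Nat.cast_pos.2 this
  have hsn : √n * √n = n := Real.mul_self_sqrt hn0.le
  -- The ideal output: Bob's discarded system K = A × B carries the purification R, with the same
  -- amplitude for each of the n outcomes.
  obtain ⟨g, hg⟩ : ∃ g : Matrix ((Fin d × A → ZMod 3) × (A × B)) (A × B) ℂ,
      ∀ x k e, g (x, k) e = ((1 / √n : ℝ) : ℂ) * R k e :=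
    ⟨fun p e => ((1 / √n : ℝ) : ℂ) * R p.2 e, fun _ _ _ => rfl⟩
  have hgR : hsSq g = hsSq R := by
    have h1 : ∀ k e, ‖((1 / √n : ℝ) : ℂ) * R k e‖ ^ 2 = 1 / n * ‖R k e‖ ^ 2 := by
      intro k e
      rw [norm_mul, mul_pow, Complex.norm_real, Real.norm_eq_abs, sq_abs, div_pow, one_pow, sq,
        hsn]
    unfold hsSq
    rw [Fintype.sum_prod_type]
    simp only [hg, h1]
    simp only [← Finset.mul_sum]
    rw [Finset.sum_const, Finset.card_univ, nsmul_eq_mul, ← hn, ← mul_assoc, one_div_mul_cancel hn0.ne',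
      one_mul]
  refine overlap_bound hρ hρ' hfid hξ hη hξη hV hgR hr hr' ?_
  have htr : (gᴴ * V * R).trace = ((1 / (n * d) : ℝ) : ℂ) *
      ∑ x, ((((1 : Op (Fin d)) ⊗ₖ Rᵀ)ᴴ * ((phaseMatrix x ⊗ₖ (1 : Op (A × B))) * reshape R)) *
          T x).trace := by
    rw [Matrix.mul_assoc, trace_conjTranspose_mul, Fintype.sum_prod_type, Finset.mul_sum]
    refine Finset.sum_congr rfl fun x _ => ?_
    rw [trace_decoder_eq]
    simp only [Finset.mul_sum _ _ ((1 / (n * d) : ℝ) : ℂ)]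
    refine Finset.sum_congr rfl fun k _ => Finset.sum_congr rfl fun e _ => ?_
    have h1 : (V * R) (x, k) e = ((1 / (d * √n) : ℝ) : ℂ) *
        ∑ a, ∑ b, (∑ i, phaseMatrix x i a * T x b (i, k)) * R (a, b) e := by
      rw [Matrix.mul_apply, Fintype.sum_prod_type, Finset.mul_sum]
      refine Finset.sum_congr rfl fun a _ => ?_
      rw [Finset.mul_sum]
      refine Finset.sum_congr rfl fun b _ => ?_
      rw [hVe, mul_assoc]
    have h2 : 1 / √n * (1 / (d * √n)) = 1 / (n * d) := by
      rw [div_mul_div_comm, one_mul, mul_left_comm, hsn, mul_comm]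
    rw [h1, hg, star_mul', RCLike.star_def, Complex.conj_ofReal, ← h2, Complex.ofReal_mul]
    ring
  rw [htr, Complex.re_ofReal_mul, Complex.re_sum]
  have h3 : hsSq R - √(d * κ') / 2 ≤ 1 / (n * d) *
      ∑ x, ((((1 : Op (Fin d)) ⊗ₖ Rᵀ)ᴴ * ((phaseMatrix x ⊗ₖ (1 : Op (A × B))) * reshape R)) *
          T x).trace.re := by
    rw [one_div, ← div_eq_inv_mul, le_div_iff₀ (by positivity), mul_comm]
    exact hTsum
  linarith

end Protocol

end QInfo

end

/-! ### The theorem: choice of constants -/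

theorem mainTheorem12 {A B : Type*} [Fintype A] [DecidableEq A] [Fintype B] [DecidableEq B]
    (ρ : QInfo.Op (A × B)) (hρ : QInfo.IsState ρ)
    (ε η : ℝ) (hε : ε ∈ Set.Icc (0 : ℝ) 1) (hη : η ∈ Set.Ico (0 : ℝ) (√ε))
    (d : ℕ) (hd : 1 ≤ d)
    (hlog : QInfo.log2 (d : ℝ≥0∞) ≤
      -QInfo.smoothMaxEntropy (√ε - η) ρ - 4 * QInfo.log2 (1 / ENNReal.ofReal η)) :
    ∃ L : QInfo.Op (A × B) →ₗ[ℂ] QInfo.Op (Fin d × Fin d),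
      QInfo.IsOneWayLOCC L ∧
        1 - ε ≤ QInfo.fidelity (QInfo.maxEntState d) (L ρ) := by
  obtain ⟨hε0, hε1⟩ := hε
  obtain ⟨hη0, hη1⟩ := hη
  have hd0 : (0 : ℝ) < d := by exact_mod_cast hd
  have he1 : √ε ≤ 1 := Real.sqrt_le_one.2 hε1
  -- At η = 0 the right-hand side of the condition is -∞, while log d is finite.
  have hηpos : 0 < η := by
    refine hη0.lt_of_ne fun h => ?_
    rw [← h] at hlog
    have h2 : QInfo.log2 (1 / ENNReal.ofReal 0) = ⊤ := by
      rw [ENNReal.ofReal_zero, one_div, ENNReal.inv_zero, QInfo.log2, ENNReal.log_top]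
      exact EReal.top_div_of_pos_ne_top (by exact_mod_cast Real.log_pos one_lt_two)
        (EReal.coe_ne_top _)
    rw [h2, EReal.mul_top_of_pos (by norm_num), EReal.sub_top,
      show (d : ℝ≥0∞) = ENNReal.ofReal d by simp, QInfo.log2_ofReal hd0] at hlog
    exact absurd (le_bot_iff.1 hlog) (EReal.coe_ne_bot _)
  have hA : Nonempty A := by
    by_contra h
    rw [not_nonempty_iff] at h
    have := hρ.2
    simp [Matrix.trace] at this
  obtain ⟨ρ', hρ', hF⟩ := QInfo.exists_mem_purifiedBall_fidelity_le hηpos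
    (θ := η ^ 2 / 4) (by positivity) hd hlog
  have hfid := QInfo.fidelity_ge_of_mem_purifiedBall hρ (by linarith) hρ'
  have hη2 : η ^ 2 ≤ 1 := pow_le_one₀ hη0 (by linarith)
  have hη20 : 0 ≤ η ^ 2 := sq_nonneg η
  have hεs : √ε - η + η = √ε := by ring
  -- The slack in (1 - η²/2)² = 1 - η² + η⁴/4 is split: κ has the factor 1 + η²/4, κ' has 1 + η²/2 ≤
  -- (1 + η²/4)², and r = η²(1 + η²/4)/2 dominates √(dκ')/2 while (1 - r)² is still at least 1 - η².
  obtain ⟨L, hL, hLF⟩ := QInfo.exists_oneWayLOCC_fidelity_ge hρ hρ'.1 hfid (by linarith) hη0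
    (by linarith) (by positivity) (κ' := η ^ 4 * (1 + η ^ 2 / 2) / d)
    (by gcongr; norm_num) hF hd (r := η ^ 2 * (1 + η ^ 2 / 4) / 2) (by nlinarith) (by
      have h1 : (1 - η ^ 2 * (1 + η ^ 2 / 4) / 2) ^ 2 =
          1 - η ^ 2 + (η ^ 2) ^ 3 / 8 + (η ^ 2) ^ 4 / 64 := by ring
      rw [h1]
      have := pow_nonneg hη20 3
      have := pow_nonneg hη20 4
      linarith) (by
      rw [mul_div_cancel₀ _ hd0.ne']
      gcongr
      refine Real.sqrt_le_iff.2 ⟨by positivity, ?_⟩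
      have h1 : (η ^ 2 * (1 + η ^ 2 / 4)) ^ 2 =
          η ^ 4 * (1 + η ^ 2 / 2) + η ^ 8 / 16 := by ring
      rw [h1]
      have : 0 ≤ η ^ 8 := by positivity
      linarith)
  refine ⟨L, hL, ?_⟩
  rwa [hεs, Real.sq_sqrt hε0] at hLF
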